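/- Let $H$ be a separable (infinite-dimensional, real or complex) Hilbert space, and let $A$ be a positive self-adjoint unbounded operator in $H$ with domain $D(A)$, having a complete orthonormal system of eigenvectors $\{v_k\}_{k\ge1}$, $Av_k=\lambda_kv_k$, with $0<\lambda_1\le\lambda_2\le\cdots\to+\infty$. Let $\alpha\in(0,1)$, $\beta>-\alpha$, $\mu>-1$, $T>0$ and $\varphi,f\in H$. For $h:(0,\infty)\to H$ put $$J^{\alpha-1}h(t)=\frac1{\Gamma(1-\alpha)}\int_0^t\frac{h(\xi)}{(t-\xi)^{\alpha}}\,d\xi,\qquad \partial_t^\alpha h(t)=\frac{d}{dt}J^{\alpha-1}h(t),\qquad t>0,$$ whenever the right-hand sides exist (Bochner integral, derivative in the norm of $H$). Consider the forward problem $$\partial_t^\alpha u(t)+t^\beta Au(t)=t^\mu f,\quad 0<t\le T;\qquad \lim_{t\to+0}J^{\alpha-1}u(t)=\varphi .$$ A solution is a continuous function $u:(0,\infty)\to H$ such that $J^{\alpha-1}u(t)$ and $\partial_t^\alpha u(t)$ exist and $u(t)\in D(A)$ for all $t>0$, $J^{\alpha-1}u$ extends continuously to $[0,\infty)$, $\partial_t^\alpha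 u$ and $Au$ are continuous on $(0,\infty)$, and both relations of the problem hold. For real $m,l$ let $$E_{\alpha,m,l}(z)=\sum_{n=0}^\infty c_nz^n,\qquad c_0=1,\quad c_n=\prod_{j=0}^{n-1}\frac{\Gamma(\alpha(jm+l)+1)}{\Gamma(\alpha(jm+l+1)+1)} .$$ Then the problem has a solution, and any two solutions coincide on $(0,T]$. Moreover there is a solution that is given for all $t>0$ by the series, convergent in $H$, $$u(t)=\sum_{k=1}^\infty\left[\frac{\varphi_k}{\Gamma(\alpha)}t^{\alpha-1}E_{\alpha,1+\frac\beta\alpha,1+\frac{\beta-1}\alpha}(-\lambda_kt^{\alpha+\beta})+\frac{\Gamma(\mu+1)f_k}{\Gamma(\mu+\alpha+1)}t^{\alpha+\mu}E_{\alpha,1+\frac\beta\alpha,1+\frac{\beta+\mu}\alpha}(-\lambda_kt^{\alpha+\beta})\right]v_k,$$ where $\varphi_k=(\varphi,v_k)$ and $f_k=(f,v_k)$; hence every solution is given by this series on $(0,T]$. -/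

import Mathlib

open Set Filter Topology MeasureTheory

noncomputable section

/-- The coefficients `c_k = ∏_{j<k} Γ(α(jm+l)+1) / Γ(α(jm+l+1)+1)` of the three-parameter
(Kilbas–Saigo) Mittag-Leffler function. -/
def kilbasSaigoCoeff (α m l : ℝ) (k : ℕ) : ℝ :=
  ∏ j ∈ Finset.range k,
    Real.Gamma (α * (j * m + l) + 1) / Real.Gamma (α * (j * m + l + 1) + 1)

/-- The three-parameter (Kilbas–Saigo) Mittag-Leffler function
`E_{α,m,l}(z) = ∑_{k ≥ 0} c_k z^k`. -/
def kilbasSaigo (α m l z : ℝ) : ℝ :=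
  ∑' k : ℕ, kilbasSaigoCoeff α m l k * z ^ k

section Fractional

variable {H : Type*} [NormedAddCommGroup H] [NormedSpace ℝ H]

/-- Integrand of the Riemann–Liouville integral of order `σ < 0` at time `t`. -/
def rlIntegrand (σ : ℝ) (h : ℝ → H) (t ξ : ℝ) : H := (t - ξ) ^ (-(σ + 1)) • h ξ

/-- The Riemann–Liouville integral
`J^σ h(t) = (1 / Γ(-σ)) ∫_0^t h(ξ) / (t - ξ)^(σ+1) dξ` of order `σ < 0` (Bochner integral). -/
def rlIntegral (σ : ℝ) (h : ℝ → H) (t : ℝ) : H :=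
  (1 / Real.Gamma (-σ)) • ∫ ξ in (0 : ℝ)..t, rlIntegrand σ h t ξ

/-- The Riemann–Liouville derivative `∂_t^α h = (d/dt) J^{α-1} h`. -/
def rlDeriv (α : ℝ) (h : ℝ → H) (t : ℝ) : H := deriv (rlIntegral (α - 1) h) t

end Fractional

section Problem

variable {𝕜 H : Type*} [RCLike 𝕜] [NormedAddCommGroup H] [InnerProductSpace 𝕜 H]
  [NormedSpace ℝ H]

/-- `u` is a solution of the forward problem
`∂_t^α u(t) + t^β A u(t) = t^μ f` for `0 < t ≤ T`, `lim_{t → +0} J^{α-1} u(t) = φ`.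
Only the values of `u` on `(0, ∞)` matter. -/
structure IsForwardSolution (A : H →ₗ.[𝕜] H) (α β μ T : ℝ) (φ f : H) (u : ℝ → H) : Prop where
  /-- `u ∈ C((0, ∞); H)` -/
  continuousOn : ContinuousOn u (Ioi 0)
  /-- the integral defining `J^{α-1} u(t)` exists for every `t > 0` -/
  integrable : ∀ t : ℝ, 0 < t → IntervalIntegrable (rlIntegrand (α - 1) u t) volume 0 t
  /-- `J^{α-1} u ∈ C([0, ∞); H)`; the value at `0` is the one given by continuity, since the
  integral itself is defined for `t > 0` -/
  continuousOn_integral :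
    ∃ w : ℝ → H, ContinuousOn w (Ici 0) ∧ ∀ t : ℝ, 0 < t → w t = rlIntegral (α - 1) u t
  /-- `∂_t^α u(t)` exists for every `t > 0` -/
  differentiable : ∀ t : ℝ, 0 < t → DifferentiableAt ℝ (rlIntegral (α - 1) u) t
  /-- `∂_t^α u ∈ C((0, ∞); H)` -/
  continuousOn_deriv : ContinuousOn (rlDeriv α u) (Ioi 0)
  /-- `u(t) ∈ D(A)` for every `t > 0` -/
  mem_domain : ∀ t : ℝ, 0 < t → u t ∈ A.domain
  /-- `A u ∈ C((0, ∞); H)` -/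
  continuous_apply : Continuous fun t : Ioi (0 : ℝ) => A ⟨u t, mem_domain t t.2⟩
  /-- the equation on `(0, T]` -/
  equation : ∀ (t : ℝ) (ht : t ∈ Ioc 0 T),
    rlDeriv α u t + t ^ β • A ⟨u t, mem_domain t ht.1⟩ = t ^ μ • f
  /-- the initial condition -/
  initial : Tendsto (rlIntegral (α - 1) u) (𝓝[>] 0) (𝓝 φ)

end Problem

end

/-! The eigenbasis splits the problem into scalar equations `∂_t^α y + λ t^β y = t^μ c`. Integrating
power series term by term shows that `t^(α+μ) E(-λ t^(α+β))` solves such an equation with source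
`Γ(α+μ+1)/Γ(μ+1) t^μ`. All scalar lemmas allow `μ = -1`: there the source vanishes, because `1/Γ`
vanishes at `0`, and `J^{α-1}` of the function has a nonzero limit at `0`. One family thus serves
the initial datum (`μ = -1`) and the source term (`μ > -1`).

Summing over the eigenvalues needs bounds uniform in `λ`: `0 < E(-x) ≤ 1` and `x E(-x) ≤ C` for `x ≥
0`. They rest on an extremum principle: if `V` is positive before `t` and at most `C (t - s)` just
before `t`, then the derivative of `J^{α-1} V` at `t` is negative (`deriv_rlIntegral_neg`). At a
first zero the equation would make that derivative nonnegative, so the solution stays positive.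
Applied to a difference of two solutions, the same argument shows that `E(-x)` is decreasing. The
mean value theorem for `J^{α-1} y`, together with monotonicity, gives the bound on `x E(-x)`.
Dominated convergence in the coordinates then yields continuity, the initial value and the
derivative of the vector series, and `A = A*` puts its values in `D(A)`.

For uniqueness, a real or imaginary part `z` of a coordinate of the difference satisfies `W' = -q z`
with `q > 0`, where `W = J^{α-1} z` tends to `0` at `0`. At a positive maximum `t₀` of `W` the
extremum principle for `W(t₀) - W`, now with fractional order `α`, and the identity `J^{-α} W = ∫ z`
force `z(t₀) > 0`. Then `W'(t₀) < 0`, which is impossible at a maximum over `[0, t₀]`. Working with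
`W` avoids any differentiability of `z` and any control of `z` at `0`. -/

noncomputable section

/-! ### Beta integrals and the decay of Gamma quotients. -/

section PowerIntegrals

theorem intervalIntegrable_sub_rpow_mul_rpow {a b t : ℝ} (ha : -1 < a) (hb : -1 < b)
    (ht : 0 < t) : IntervalIntegrable (fun s => (t - s) ^ a * s ^ b) volume 0 t := by
  -- Splitting at `t / 2` leaves one endpoint singularity on each half.
  have h1 : IntervalIntegrable (fun s => (t - s) ^ a * s ^ b) volume 0 (t / 2) := by
    refine (intervalIntegral.intervalIntegrable_rpow' hb).continuousOn_mul ?_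
    rw [uIcc_of_le (by positivity)]
    refine ContinuousOn.rpow_const (by fun_prop) fun s hs => Or.inl ?_
    have := hs.2
    linarith
  have h2 : IntervalIntegrable (fun s => (t - s) ^ a * s ^ b) volume (t / 2) t := by
    have h3 : IntervalIntegrable (fun s : ℝ => (t - s) ^ a) volume (t / 2) t := by
      have := (intervalIntegral.intervalIntegrable_rpow' ha (a := t / 2) (b := 0)).comp_sub_left t
      simpa [sub_half] using this
    refine h3.mul_continuousOn ?_
    rw [uIcc_of_le (by linarith)]
    refine ContinuousOn.rpow_const (by fun_prop) fun s hs => Or.inl ?_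
    have := hs.1
    linarith
  exact h1.trans h2

theorem integral_sub_rpow_mul_rpow {a b t : ℝ} (ha : -1 < a) (hb : -1 < b) (ht : 0 < t) :
    ∫ s in (0 : ℝ)..t, (t - s) ^ a * s ^ b
      = t ^ (a + b + 1) * (Real.Gamma (a + 1) * Real.Gamma (b + 1) / Real.Gamma (a + b + 2)) := by
  have h := Complex.betaIntegral_scaled ((b + 1 : ℝ) : ℂ) ((a + 1 : ℝ) : ℂ) ht
  rw [Complex.betaIntegral_eq_Gamma_mul_div _ _ (by simp; linarith) (by simp; linarith)] at h
  have h2 : ∫ x in (0 : ℝ)..t,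
      (x : ℂ) ^ (((b + 1 : ℝ) : ℂ) - 1) * ((t : ℂ) - x) ^ (((a + 1 : ℝ) : ℂ) - 1)
      = ((∫ s in (0 : ℝ)..t, (t - s) ^ a * s ^ b : ℝ) : ℂ) := by
    rw [← intervalIntegral.integral_ofReal]
    refine intervalIntegral.integral_congr fun x hx => ?_
    rw [uIcc_of_le ht.le] at hx
    have h3 : (0 : ℝ) ≤ t - x := by linarith [hx.2]
    simp only [Complex.ofReal_mul]
    rw [Complex.ofReal_cpow h3, Complex.ofReal_cpow hx.1]
    push_cast
    rw [add_sub_cancel_right, add_sub_cancel_right, mul_comm]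
  rw [h2, ← Complex.ofReal_add, Complex.Gamma_ofReal, Complex.Gamma_ofReal, Complex.Gamma_ofReal,
    ← Complex.ofReal_one, ← Complex.ofReal_sub, ← Complex.ofReal_cpow ht.le] at h
  have h4 := Complex.ofReal_injective (h.trans (by push_cast; rfl) : _ =
    ((t ^ (b + 1 + (a + 1) - 1) * (Real.Gamma (b + 1) * Real.Gamma (a + 1) /
      Real.Gamma (b + 1 + (a + 1))) : ℝ) : ℂ))
  rw [h4, show b + 1 + (a + 1) - 1 = a + b + 1 by ring, show b + 1 + (a + 1) = a + b + 2 by ring,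
    mul_comm (Real.Gamma (b + 1))]

theorem intervalIntegrable_sub_rpow_mul_sub_rpow {a b r t : ℝ} (ha : -1 < a) (hb : -1 < b)
    (ht : r < t) : IntervalIntegrable (fun s => (t - s) ^ a * (s - r) ^ b) volume r t := by
  have := (intervalIntegrable_sub_rpow_mul_rpow ha hb (sub_pos.2 ht)).comp_sub_right r
  simpa using this

theorem integral_sub_rpow_mul_sub_rpow {a b r t : ℝ} (ha : -1 < a) (hb : -1 < b) (ht : r < t) :
    ∫ s in r..t, (t - s) ^ a * (s - r) ^ b = (t - r) ^ (a + b + 1) *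
      (Real.Gamma (a + 1) * Real.Gamma (b + 1) / Real.Gamma (a + b + 2)) := by
  rw [← integral_sub_rpow_mul_rpow ha hb (sub_pos.2 ht)]
  have := intervalIntegral.integral_comp_sub_right (a := r) (b := t)
    (fun s => (t - r - s) ^ a * s ^ b) r
  simpa using this

/-- Log-convexity of `Γ` at `x + 1 = a (x + a) + (1 - a)(x + a + 1)` gives `x Γ(x) ≤ (x + a)^(1-a)
Γ(x + a)`, so the quotient is at most `2 x^(-a)` for `x ≥ 1`. -/
theorem tendsto_Gamma_div_Gamma_add {a : ℝ} (ha : a ∈ Ioo (0 : ℝ) 1) :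
    Tendsto (fun x => Real.Gamma x / Real.Gamma (x + a)) atTop (𝓝 0) := by
  have h1 : Tendsto (fun x : ℝ => 2 * x ^ (-a)) atTop (𝓝 0) := by
    simpa using (tendsto_rpow_neg_atTop ha.1).const_mul 2
  refine squeeze_zero' ?_ ?_ h1
  · filter_upwards [eventually_gt_atTop 0] with x hx
    have := Real.Gamma_pos_of_pos hx
    have := Real.Gamma_pos_of_pos (add_pos hx ha.1)
    positivity
  · filter_upwards [eventually_ge_atTop 1] with x hx
    have hx0 : 0 < x := by linarith
    have hxa : 0 < x + a := add_pos hx0 ha.1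
    have hG := Real.Gamma_pos_of_pos hxa
    have h := Real.Gamma_mul_add_mul_le_rpow_Gamma_mul_rpow_Gamma hxa
      (by linarith : 0 < x + a + 1) ha.1 (sub_pos.2 ha.2) (by ring)
    rw [show a * (x + a) + (1 - a) * (x + a + 1) = x + 1 by ring, Real.Gamma_add_one hx0.ne',
      Real.Gamma_add_one hxa.ne', Real.mul_rpow hxa.le hG.le, mul_left_comm,
      ← Real.rpow_add hG, add_sub_cancel, Real.rpow_one] at h
    rw [div_le_iff₀ hG]
    have h2 : (x + a) ^ (1 - a) ≤ 2 * x ^ (1 - a) := by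
      calc (x + a) ^ (1 - a) ≤ (2 * x) ^ (1 - a) :=
            Real.rpow_le_rpow hxa.le (by linarith [ha.2]) (by linarith [ha.2])
        _ = 2 ^ (1 - a) * x ^ (1 - a) := Real.mul_rpow (by norm_num) hx0.le
        _ ≤ 2 ^ (1 : ℝ) * x ^ (1 - a) := by
            gcongr
            · norm_num
            · linarith [ha.1]
        _ = _ := by norm_num
    have h3 : x ^ (1 - a) = x * x ^ (-a) := by
      rw [sub_eq_add_neg, Real.rpow_add hx0, Real.rpow_one]
    have h4 : x * Real.Gamma x ≤ x * (2 * x ^ (-a) * Real.Gamma (x + a)) := by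
      calc _ ≤ _ := h
        _ ≤ (2 * x ^ (1 - a)) * Real.Gamma (x + a) := by gcongr
        _ = _ := by rw [h3]; ring
    exact le_of_mul_le_mul_left h4 hx0

end PowerIntegrals

/-! ### Elementary calculus of the Riemann–Liouville integral. -/

section Fractional

theorem intervalIntegrable_rlIntegrand_rpow {σ p t : ℝ} (hσ : σ < 0) (hp : -1 < p) (ht : 0 < t) :
    IntervalIntegrable (rlIntegrand σ (fun s : ℝ => s ^ p) t) volume 0 t :=
  intervalIntegrable_sub_rpow_mul_rpow (by linarith) hp ht

theorem rlIntegral_rpow {σ p t : ℝ} (hσ : σ < 0) (hp : -1 < p) (ht : 0 < t) :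
    rlIntegral σ (fun s : ℝ => s ^ p) t
      = Real.Gamma (p + 1) / Real.Gamma (p + 1 - σ) * t ^ (p - σ) := by
  have h : ∫ s in (0 : ℝ)..t, rlIntegrand σ (fun s : ℝ => s ^ p) t s = _ :=
    integral_sub_rpow_mul_rpow (by linarith : -1 < -(σ + 1)) hp ht
  have hG := Real.Gamma_pos_of_pos (neg_pos.2 hσ)
  rw [rlIntegral, h, smul_eq_mul, show -(σ + 1) + p + 1 = p - σ by ring,
    show -(σ + 1) + 1 = -σ by ring, show -(σ + 1) + p + 2 = p + 1 - σ by ring]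
  field_simp

variable {H : Type*} [NormedAddCommGroup H] [NormedSpace ℝ H]

theorem aestronglyMeasurable_rlIntegrand {h : ℝ → H} (hc : ContinuousOn h (Ioi 0)) (σ t : ℝ) :
    AEStronglyMeasurable (rlIntegrand σ h t) (volume.restrict (Ioc 0 t)) := by
  refine AEStronglyMeasurable.smul ?_ ?_
  · exact (by fun_prop : Measurable fun ξ : ℝ => (t - ξ) ^ (-(σ + 1))).aestronglyMeasurable
  · exact (hc.mono fun x hx => hx.1).aestronglyMeasurable measurableSet_Ioc

theorem intervalIntegrable_rlIntegrand_of_norm_le {h : ℝ → H} {g : ℝ → ℝ} {σ t : ℝ}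
    (hc : ContinuousOn h (Ioi 0)) (ht : 0 < t)
    (hg : IntervalIntegrable (rlIntegrand σ g t) volume 0 t) (hle : ∀ s, 0 < s → ‖h s‖ ≤ g s) :
    IntervalIntegrable (rlIntegrand σ h t) volume 0 t := by
  rw [intervalIntegrable_iff_integrableOn_Ioc_of_le ht.le] at hg ⊢
  refine Integrable.mono' hg (aestronglyMeasurable_rlIntegrand hc σ t) ?_
  refine (ae_restrict_iff' measurableSet_Ioc).2 (ae_of_all _ fun s hs => ?_)
  have h0 : (0 : ℝ) ≤ (t - s) ^ (-(σ + 1)) := Real.rpow_nonneg (by linarith [hs.2]) _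
  rw [rlIntegrand, rlIntegrand, norm_smul, Real.norm_of_nonneg h0, smul_eq_mul]
  exact mul_le_mul_of_nonneg_left (hle s hs.1) h0

theorem rlIntegral_add {h₁ h₂ : ℝ → H} {σ t : ℝ}
    (i₁ : IntervalIntegrable (rlIntegrand σ h₁ t) volume 0 t)
    (i₂ : IntervalIntegrable (rlIntegrand σ h₂ t) volume 0 t) :
    rlIntegral σ (fun s => h₁ s + h₂ s) t = rlIntegral σ h₁ t + rlIntegral σ h₂ t := by
  have : rlIntegrand σ (fun s => h₁ s + h₂ s) t
      = fun s => rlIntegrand σ h₁ t s + rlIntegrand σ h₂ t s := by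
    funext s; simp [rlIntegrand]
  rw [rlIntegral, this, intervalIntegral.integral_add i₁ i₂, smul_add]
  rfl

theorem rlIntegral_sub {h₁ h₂ : ℝ → H} {σ t : ℝ}
    (i₁ : IntervalIntegrable (rlIntegrand σ h₁ t) volume 0 t)
    (i₂ : IntervalIntegrable (rlIntegrand σ h₂ t) volume 0 t) :
    rlIntegral σ (fun s => h₁ s - h₂ s) t = rlIntegral σ h₁ t - rlIntegral σ h₂ t := by
  have : rlIntegrand σ (fun s => h₁ s - h₂ s) t
      = fun s => rlIntegrand σ h₁ t s - rlIntegrand σ h₂ t s := by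
    funext s; simp [rlIntegrand, smul_sub]
  rw [rlIntegral, this, intervalIntegral.integral_sub i₁ i₂, smul_sub]
  rfl

theorem rlIntegrand_const_smul (c : ℝ) (h : ℝ → H) (σ t : ℝ) :
    rlIntegrand σ (fun s => c • h s) t = fun s => c • rlIntegrand σ h t s := by
  funext s; simp [rlIntegrand, smul_comm c]

theorem rlIntegral_const_smul (c : ℝ) (h : ℝ → H) (σ t : ℝ) :
    rlIntegral σ (fun s => c • h s) t = c • rlIntegral σ h t := by
  rw [rlIntegral, rlIntegrand_const_smul, intervalIntegral.integral_smul, smul_comm]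
  rfl

theorem intervalIntegrable_rlIntegrand_clm {F : Type*} [NormedAddCommGroup F] [NormedSpace ℝ F]
    (L : H →L[ℝ] F) {h : ℝ → H} {σ t : ℝ}
    (hi : IntervalIntegrable (rlIntegrand σ h t) volume 0 t) :
    IntervalIntegrable (rlIntegrand σ (fun s => L (h s)) t) volume 0 t := by
  have : rlIntegrand σ (fun s => L (h s)) t = fun s => L (rlIntegrand σ h t s) := by
    funext s; simp [rlIntegrand]
  rw [this]
  exact ⟨L.integrable_comp hi.1, L.integrable_comp hi.2⟩

theorem rlIntegral_clm [CompleteSpace H] {F : Type*} [NormedAddCommGroup F] [NormedSpace ℝ F]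
    [CompleteSpace F] (L : H →L[ℝ] F) {h : ℝ → H} {σ t : ℝ}
    (hi : IntervalIntegrable (rlIntegrand σ h t) volume 0 t) :
    rlIntegral σ (fun s => L (h s)) t = L (rlIntegral σ h t) := by
  have : rlIntegrand σ (fun s => L (h s)) t = fun s => L (rlIntegrand σ h t s) := by
    funext s; simp [rlIntegrand]
  rw [rlIntegral, this, L.intervalIntegral_comp_comm hi, ← map_smul]
  rfl

theorem rlIntegral_mono {g h : ℝ → ℝ} {σ t : ℝ} (hσ : σ < 0) (ht : 0 < t)
    (hg : IntervalIntegrable (rlIntegrand σ g t) volume 0 t)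
    (hh : IntervalIntegrable (rlIntegrand σ h t) volume 0 t) (hle : ∀ s ∈ Ioo 0 t, g s ≤ h s) :
    rlIntegral σ g t ≤ rlIntegral σ h t := by
  have hG := Real.Gamma_pos_of_pos (neg_pos.2 hσ)
  refine mul_le_mul_of_nonneg_left ?_ (by positivity)
  refine intervalIntegral.integral_mono_on_of_le_Ioo ht.le hg hh fun s hs => ?_
  exact mul_le_mul_of_nonneg_left (hle s hs) (Real.rpow_nonneg (by linarith [hs.2]) _)

end Fractional

/-! ### Extremum principle for the Riemann–Liouville derivative. -/

section LeftMinimum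

/-- The mean value theorem for `x^(-q)`. It measures how much the kernel at a fixed earlier time
drops when the upper time advances by `h`. -/
theorem mul_rpow_le_rpow_neg_sub_rpow_neg {q r h t : ℝ} (hq : 0 < q) (hr : 0 < r) (hh : 0 < h)
    (ht : r + h ≤ t) : h * (q * t ^ (-q - 1)) ≤ r ^ (-q) - (r + h) ^ (-q) := by
  obtain ⟨c, hc, hc'⟩ := exists_hasDerivAt_eq_slope (fun x : ℝ => x ^ (-q))
    (fun x => -q * x ^ (-q - 1)) (by linarith : r < r + h)
    (ContinuousOn.rpow_const continuousOn_id fun x hx =>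
      Or.inl (hr.trans_le hx.1).ne')
    (fun x hx => Real.hasDerivAt_rpow_const (Or.inl (by linarith [hx.1])))
  have hc0 : 0 < c := hr.trans hc.1
  have h1 : t ^ (-q - 1) ≤ c ^ (-q - 1) :=
    Real.rpow_le_rpow_of_nonpos hc0 (by linarith [hc.2]) (by linarith)
  rw [eq_div_iff (by linarith)] at hc'
  have h2 : r ^ (-q) - (r + h) ^ (-q) = h * (q * c ^ (-q - 1)) := by
    have : (r + h - r) = h := by ring
    rw [this] at hc'
    linarith
  rw [h2]
  gcongr

theorem intervalIntegrable_of_rlIntegrand {V : ℝ → ℝ} {σ t : ℝ} (hσ : σ ∈ Ioo (-1 : ℝ) 0)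
    (ht : 0 < t) (hi : IntervalIntegrable (rlIntegrand σ V t) volume 0 t) :
    IntervalIntegrable V volume 0 t := by
  have h1 : IntervalIntegrable (fun s => (t - s) ^ (σ + 1) * rlIntegrand σ V t s) volume 0 t := by
    refine hi.continuousOn_mul (ContinuousOn.rpow_const (by fun_prop) fun s _ => Or.inr ?_)
    linarith [hσ.1]
  rw [intervalIntegrable_iff_integrableOn_Ioo_of_le ht.le] at h1 ⊢
  refine h1.congr_fun (fun s hs => ?_) measurableSet_Ioo
  have h0 : 0 < t - s := by linarith [hs.2]
  simp only [rlIntegrand, smul_eq_mul]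
  rw [← mul_assoc, ← Real.rpow_add h0]
  simp

/-- The increment of the integral has three parts. On `[t - h, t]` the linear bound on `V` tames the
kernel and leaves `O(h^(1-σ))`. On `[t/2, t - h]` the kernel has decreased, so the contribution is
at most `0` and is dropped. On `[0, t/2]` the kernel has dropped by a fixed multiple of `h`, which
gives the negative main term. -/
theorem Gamma_mul_rlIntegral_sub_le {V : ℝ → ℝ} {σ t h C : ℝ} (hσ : σ ∈ Ioo (-1 : ℝ) 0)
    (hh : 0 < h) (hht : h < t / 2)
    (hi : IntervalIntegrable (rlIntegrand σ V t) volume 0 t)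
    (hi' : IntervalIntegrable (rlIntegrand σ V (t - h)) volume 0 (t - h))
    (hV : ∀ s ∈ Ioo 0 t, 0 ≤ V s) (hC : ∀ s ∈ Ioo (t - h) t, V s ≤ C * (t - s)) :
    Real.Gamma (-σ) * (rlIntegral σ V t - rlIntegral σ V (t - h)) ≤
      C * (h * h ^ (-σ)) - h * ((σ + 1) * t ^ (-(σ + 1) - 1)) * ∫ s in (0 : ℝ)..t / 2, V s := by
  have ht : 0 < t := by linarith
  have hG := Real.Gamma_pos_of_pos (neg_pos.2 hσ.2)
  -- The bounds `0 ≤ V s ≤ C (t - s)` at one point already force the sign of `C`.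
  have hC0 : 0 ≤ C := by
    have h1 := hC (t - h / 2) ⟨by linarith, by linarith⟩
    have h2 := hV (t - h / 2) ⟨by linarith, by linarith⟩
    by_contra hneg
    nlinarith
  have sub {a b c d : ℝ} {g : ℝ → ℝ} (hg : IntervalIntegrable g volume a b) (h1 : a ≤ c)
      (h2 : c ≤ d) (h3 : d ≤ b) : IntervalIntegrable g volume c d :=
    hg.mono_set (by
      rw [uIcc_of_le h2, uIcc_of_le (h1.trans (h2.trans h3))]
      exact Icc_subset_Icc h1 h3)
  have e1 : Real.Gamma (-σ) * (rlIntegral σ V t - rlIntegral σ V (t - h)) =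
      (∫ s in (0 : ℝ)..t, rlIntegrand σ V t s) -
        ∫ s in (0 : ℝ)..t - h, rlIntegrand σ V (t - h) s := by
    simp only [rlIntegral, smul_eq_mul]
    field_simp
  rw [e1, ← intervalIntegral.integral_add_adjacent_intervals
      (sub hi le_rfl (by linarith : 0 ≤ t - h) (by linarith))
      (sub hi (by linarith) (by linarith : t - h ≤ t) le_rfl),
    add_sub_right_comm, ← intervalIntegral.integral_sub
      (sub hi le_rfl (by linarith : 0 ≤ t - h) (by linarith)) hi']
  have hid : IntervalIntegrable (fun s => rlIntegrand σ V t s - rlIntegrand σ V (t - h) s)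
      volume 0 (t - h) := (sub hi le_rfl (by linarith : 0 ≤ t - h) (by linarith)).sub hi'
  have hdiff : ∀ s ∈ Ioo 0 (t - h), rlIntegrand σ V t s - rlIntegrand σ V (t - h) s ≤
      -(h * ((σ + 1) * t ^ (-(σ + 1) - 1))) * V s := by
    intro s hs
    have h1 := mul_rpow_le_rpow_neg_sub_rpow_neg (q := σ + 1) (r := t - h - s) (h := h) (t := t)
      (by linarith [hσ.1]) (by linarith [hs.2]) hh (by linarith [hs.1])
    rw [show t - h - s + h = t - s by ring] at h1
    have h2 := mul_le_mul_of_nonneg_right h1 (hV s ⟨hs.1, by linarith [hs.2]⟩)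
    simp only [rlIntegrand, smul_eq_mul]
    linarith
  have b1 : ∫ s in (0 : ℝ)..t / 2, (rlIntegrand σ V t s - rlIntegrand σ V (t - h) s) ≤
      -(h * ((σ + 1) * t ^ (-(σ + 1) - 1))) * ∫ s in (0 : ℝ)..t / 2, V s := by
    rw [← intervalIntegral.integral_const_mul]
    refine intervalIntegral.integral_mono_on_of_le_Ioo (by linarith)
      (sub hid le_rfl (by linarith) (by linarith)) ?_
      fun s hs => hdiff s ⟨hs.1, by linarith [hs.2]⟩
    exact (sub (intervalIntegrable_of_rlIntegrand hσ ht hi) le_rfl (by linarith)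
      (by linarith)).const_mul _
  have b2 : ∫ s in t / 2..t - h, (rlIntegrand σ V t s - rlIntegrand σ V (t - h) s) ≤ 0 := by
    have : ∫ s in t / 2..t - h, (rlIntegrand σ V t s - rlIntegrand σ V (t - h) s) ≤
        ∫ s in t / 2..t - h, (0 : ℝ) := by
      refine intervalIntegral.integral_mono_on_of_le_Ioo (by linarith)
        (sub hid (by linarith) (by linarith) (by linarith)) (by simp) fun s hs => ?_
      refine (hdiff s ⟨by linarith [hs.1], hs.2⟩).trans ?_
      have h1 := hV s ⟨by linarith [hs.1], by linarith [hs.2]⟩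
      have h2 : 0 < σ + 1 := by linarith [hσ.1]
      have h3 : 0 ≤ h * ((σ + 1) * t ^ (-(σ + 1) - 1)) * V s := by positivity
      linarith
    simpa using this
  have b3 : ∫ s in t - h..t, rlIntegrand σ V t s ≤ C * (h * h ^ (-σ)) := by
    have : ∫ s in t - h..t, rlIntegrand σ V t s ≤ ∫ s in t - h..t, C * h ^ (-σ) := by
      refine intervalIntegral.integral_mono_on_of_le_Ioo (by linarith)
        (sub hi (by linarith) (by linarith) le_rfl) (by simp) fun s hs => ?_
      have h0 : 0 < t - s := by linarith [hs.2]
      calc (t - s) ^ (-(σ + 1)) * V s ≤ (t - s) ^ (-(σ + 1)) * (C * (t - s)) := by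
            gcongr
            exact hC s hs
        _ = C * (t - s) ^ (-σ) := by
            rw [show -σ = -(σ + 1) + 1 by ring, Real.rpow_add h0, Real.rpow_one]
            ring
        _ ≤ C * h ^ (-σ) := by
            have : t - s ≤ h := by linarith [hs.1]
            have : 0 ≤ -σ := by linarith [hσ.2]
            gcongr
    refine this.trans (le_of_eq ?_)
    simp
  rw [← intervalIntegral.integral_add_adjacent_intervals
    (sub hid le_rfl (by linarith : 0 ≤ t / 2) (by linarith))
    (sub hid (by linarith) (by linarith : t / 2 ≤ t - h) le_rfl)]
  linarith

theorem Gamma_mul_deriv_rlIntegral_le {V : ℝ → ℝ} {σ t D C : ℝ} (hσ : σ ∈ Ioo (-1 : ℝ) 0)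
    (ht : 0 < t) (hi : ∀ s ∈ Ioc 0 t, IntervalIntegrable (rlIntegrand σ V s) volume 0 s)
    (hV : ∀ s ∈ Ioo 0 t, 0 ≤ V s) (hC : ∀ᶠ s in 𝓝[<] t, V s ≤ C * (t - s))
    (hD : HasDerivAt (rlIntegral σ V) D t) :
    Real.Gamma (-σ) * D ≤ -((σ + 1) * t ^ (-(σ + 1) - 1) * ∫ s in (0 : ℝ)..t / 2, V s) := by
  set K := (σ + 1) * t ^ (-(σ + 1) - 1) * ∫ s in (0 : ℝ)..t / 2, V s with hK
  obtain ⟨l, hl, hlC⟩ := (mem_nhdsLT_iff_exists_Ioo_subset).1 hC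
  have hlt : l < t := hl
  have hd : HasDerivAt (fun h => rlIntegral σ V (t - h)) (-D) 0 := by
    have h1 : HasDerivAt (fun h : ℝ => t - h) (-1) 0 := by
      simpa using (hasDerivAt_id (0 : ℝ)).const_sub t
    have h2 : HasDerivAt (rlIntegral σ V) D (t - 0) := by simpa using hD
    simpa [Function.comp_def] using h2.comp (0 : ℝ) h1
  have hs := (hd.tendsto_slope_zero_right).const_mul (Real.Gamma (-σ))
  -- After division by `h` the error from the last interval is `C h^(-σ)`, which vanishes in the
  -- limit because `σ < 0`.
  have hlim : Tendsto (fun h : ℝ => K - C * h ^ (-σ)) (𝓝[>] 0) (𝓝 K) := by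
    have : Tendsto (fun h : ℝ => h ^ (-σ)) (𝓝[>] 0) (𝓝 0) := by
      have h1 := (Real.continuousAt_rpow_const 0 (-σ) (Or.inr (by linarith [hσ.2]))).tendsto
      rw [Real.zero_rpow (by linarith [hσ.2])] at h1
      exact h1.mono_left nhdsWithin_le_nhds
    simpa using (this.const_mul C).const_sub K
  have := le_of_tendsto_of_tendsto hlim hs ?_
  · linarith
  have hmem : Ioo 0 (min (t / 2) (t - l)) ∈ 𝓝[>] (0 : ℝ) :=
    Ioo_mem_nhdsGT (lt_min (by linarith) (by linarith))
  filter_upwards [hmem] with h hh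
  have h1 : h < t / 2 := hh.2.trans_le (min_le_left _ _)
  have h2 : h < t - l := hh.2.trans_le (min_le_right _ _)
  have key := Gamma_mul_rlIntegral_sub_le hσ hh.1 h1 (hi t ⟨ht, le_rfl⟩)
    (hi (t - h) ⟨by linarith, by linarith [hh.1]⟩) hV
    (fun s hs => hlC ⟨by linarith [hs.1], hs.2⟩)
  have h0 := hh.1
  simp only [zero_add, sub_zero, smul_eq_mul]
  have e : Real.Gamma (-σ) * (h⁻¹ * (rlIntegral σ V (t - h) - rlIntegral σ V t)) =
      h⁻¹ * -(Real.Gamma (-σ) * (rlIntegral σ V t - rlIntegral σ V (t - h))) := by ring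
  rw [e]
  have e2 : K - C * h ^ (-σ) = h⁻¹ * -(C * (h * h ^ (-σ)) - h * K) := by
    field_simp
    ring
  rw [e2]
  refine mul_le_mul_of_nonneg_left ?_ (by positivity)
  rw [hK]
  linarith

theorem deriv_rlIntegral_nonpos {V : ℝ → ℝ} {σ t D C : ℝ} (hσ : σ ∈ Ioo (-1 : ℝ) 0)
    (ht : 0 < t) (hi : ∀ s ∈ Ioc 0 t, IntervalIntegrable (rlIntegrand σ V s) volume 0 s)
    (hV : ∀ s ∈ Ioo 0 t, 0 ≤ V s) (hC : ∀ᶠ s in 𝓝[<] t, V s ≤ C * (t - s))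
    (hD : HasDerivAt (rlIntegral σ V) D t) : D ≤ 0 := by
  have hG := Real.Gamma_pos_of_pos (neg_pos.2 hσ.2)
  have h := Gamma_mul_deriv_rlIntegral_le hσ ht hi hV hC hD
  have h1 : 0 ≤ ∫ s in (0 : ℝ)..t / 2, V s := by
    have : ∫ s in (0 : ℝ)..t / 2, (0 : ℝ) ≤ ∫ s in (0 : ℝ)..t / 2, V s := by
      refine intervalIntegral.integral_mono_on_of_le_Ioo (by linarith) (by simp) ?_
        fun s hs => hV s ⟨hs.1, by linarith [hs.2]⟩
      refine (intervalIntegrable_of_rlIntegrand hσ ht (hi t ⟨ht, le_rfl⟩)).mono_set ?_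
      rw [uIcc_of_le (by linarith), uIcc_of_le ht.le]
      exact Icc_subset_Icc le_rfl (by linarith)
    simpa using this
  have h2 : 0 < σ + 1 := by linarith [hσ.1]
  have h3 : 0 ≤ (σ + 1) * t ^ (-(σ + 1) - 1) * ∫ s in (0 : ℝ)..t / 2, V s := by positivity
  by_contra! hD0
  nlinarith [mul_pos hG hD0]

theorem deriv_rlIntegral_neg {V : ℝ → ℝ} {σ t D C : ℝ} (hσ : σ ∈ Ioo (-1 : ℝ) 0)
    (ht : 0 < t) (hi : ∀ s ∈ Ioc 0 t, IntervalIntegrable (rlIntegrand σ V s) volume 0 s)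
    (hV : ∀ s ∈ Ioo 0 t, 0 < V s) (hC : ∀ᶠ s in 𝓝[<] t, V s ≤ C * (t - s))
    (hD : HasDerivAt (rlIntegral σ V) D t) : D < 0 := by
  have hG := Real.Gamma_pos_of_pos (neg_pos.2 hσ.2)
  have h := Gamma_mul_deriv_rlIntegral_le hσ ht hi (fun s hs => (hV s hs).le) hC hD
  have h1 : 0 < ∫ s in (0 : ℝ)..t / 2, V s := by
    refine intervalIntegral.intervalIntegral_pos_of_pos_on ?_
      (fun s hs => hV s ⟨hs.1, by linarith [hs.2]⟩) (by linarith)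
    refine (intervalIntegrable_of_rlIntegrand hσ ht (hi t ⟨ht, le_rfl⟩)).mono_set ?_
    rw [uIcc_of_le (by linarith), uIcc_of_le ht.le]
    exact Icc_subset_Icc le_rfl (by linarith)
  have h2 : 0 < σ + 1 := by linarith [hσ.1]
  have h3 : 0 < (σ + 1) * t ^ (-(σ + 1) - 1) * ∫ s in (0 : ℝ)..t / 2, V s := by positivity
  by_contra! hD0
  nlinarith [mul_nonneg hG.le hD0]

theorem exists_eventually_le_mul_sub {V : ℝ → ℝ} {t : ℝ} (hd : DifferentiableAt ℝ V t)
    (h0 : V t = 0) : ∃ C : ℝ, ∀ᶠ s in 𝓝[<] t, V s ≤ C * (t - s) := by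
  obtain ⟨C, hC⟩ := hd.hasDerivAt.isBigO_sub.bound
  refine ⟨C, ?_⟩
  filter_upwards [hC.filter_mono nhdsWithin_le_nhds, self_mem_nhdsWithin] with s hs hst
  have : s < t := hst
  rw [h0, sub_zero, Real.norm_eq_abs, Real.norm_eq_abs, abs_sub_comm,
    abs_of_pos (sub_pos.2 this)] at hs
  exact (le_abs_self _).trans hs

end LeftMinimum

/-! ### Uniqueness for the scalar equation. -/

section Uniqueness

theorem setIntegral_indicator_Ioi_sub_rpow {α r t : ℝ} (hα : α ∈ Ioo (0 : ℝ) 1)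
    (hr : 0 < r) (hrt : r < t) :
    IntegrableOn ((Ioi r).indicator fun s => (t - s) ^ (α - 1) * (s - r) ^ (-α)) (Ioc 0 t) ∧
    ∫ s in Ioc 0 t, (Ioi r).indicator (fun s => (t - s) ^ (α - 1) * (s - r) ^ (-α)) s =
      Real.Gamma α * Real.Gamma (1 - α) := by
  have e : Ioc 0 t ∩ Ioi r = Ioc r t := by
    ext x
    simp only [mem_inter_iff, mem_Ioc, mem_Ioi]
    exact ⟨fun h => ⟨h.2, h.1.2⟩, fun h => ⟨⟨hr.trans h.1, h.2⟩, h.1⟩⟩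
  have e' : Ioi r ∩ Ioc 0 t = Ioc r t := by rw [inter_comm, e]
  constructor
  · rw [integrableOn_indicator_iff measurableSet_Ioi, e',
      ← intervalIntegrable_iff_integrableOn_Ioc_of_le hrt.le]
    exact intervalIntegrable_sub_rpow_mul_sub_rpow (by linarith [hα.1]) (by linarith [hα.2]) hrt
  · rw [setIntegral_indicator measurableSet_Ioi, e, ← intervalIntegral.integral_of_le hrt.le,
      integral_sub_rpow_mul_sub_rpow (by linarith [hα.1]) (by linarith [hα.2]) hrt]
    rw [show α - 1 + -α + 1 = 0 by ring, show α - 1 + -α + 2 = 1 by ring, Real.rpow_zero,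
      Real.Gamma_one, sub_add_cancel, neg_add_eq_sub]
    ring

/-- The semigroup law for orders adding up to one: by Fubini the inner integral is a Beta integral
whose power of `t - r` is zero, so it is the constant `Γ(α) Γ(1 - α)`. -/
theorem rlIntegral_neg_rlIntegral_sub_one {z : ℝ → ℝ} {α t : ℝ} (hα : α ∈ Ioo (0 : ℝ) 1)
    (ht : 0 < t) (hi : IntervalIntegrable z volume 0 t) :
    rlIntegral (-α) (rlIntegral (α - 1) z) t = ∫ r in (0 : ℝ)..t, z r := by
  -- The kernel is extended by zero off the triangle `r < s`, so that Fubini applies on a square.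
  set f : ℝ → ℝ → ℝ := fun r s =>
    (Ioi r).indicator (fun s => (t - s) ^ (α - 1) * (s - r) ^ (-α)) s * z r with hf
  set ν := (volume : Measure ℝ).restrict (Ioc 0 t) with hν
  have hG1 := Real.Gamma_pos_of_pos hα.1
  have hG2 := Real.Gamma_pos_of_pos (sub_pos.2 hα.2)
  have hzν : Integrable z ν := by
    rwa [intervalIntegrable_iff_integrableOn_Ioc_of_le ht.le] at hi
  have hlt : ∀ᵐ r ∂ν, r ∈ Ioo 0 t := by
    rw [hν, Measure.restrict_congr_set Ioo_ae_eq_Ioc.symm]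
    exact ae_restrict_mem measurableSet_Ioo
  have hmeas : AEStronglyMeasurable (Function.uncurry f) (ν.prod ν) := by
    have h1 : Function.uncurry f = fun p : ℝ × ℝ =>
        {p : ℝ × ℝ | p.1 < p.2}.indicator
          (fun p => (t - p.2) ^ (α - 1) * (p.2 - p.1) ^ (-α)) p * z p.1 := by
      funext p
      simp [f, Function.uncurry, indicator]
    rw [h1]
    refine AEStronglyMeasurable.mul ?_ hzν.aestronglyMeasurable.comp_fst
    refine (Measurable.indicator ?_ (measurableSet_lt measurable_fst measurable_snd)
      ).aestronglyMeasurable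
    fun_prop
  have hnn : ∀ r s, s ∈ Ioc 0 t →
      0 ≤ (Ioi r).indicator (fun s => (t - s) ^ (α - 1) * (s - r) ^ (-α)) s := by
    intro r s hs
    refine indicator_apply_nonneg fun hrs => ?_
    have h1 : 0 ≤ t - s := by linarith [hs.2]
    have h2 : 0 ≤ s - r := by linarith [mem_Ioi.1 hrs]
    positivity
  have hint : Integrable (Function.uncurry f) (ν.prod ν) := by
    rw [integrable_prod_iff hmeas]
    constructor
    · filter_upwards [hlt] with r hr
      exact (setIntegral_indicator_Ioi_sub_rpow hα hr.1 hr.2).1.mul_const (z r)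
    · refine (hzν.norm.const_mul (Real.Gamma α * Real.Gamma (1 - α))).congr ?_
      filter_upwards [hlt] with r hr
      rw [← (setIntegral_indicator_Ioi_sub_rpow hα hr.1 hr.2).2, ← integral_mul_const]
      refine setIntegral_congr_fun measurableSet_Ioc fun s hs => ?_
      simp only [Function.uncurry, f, norm_mul]
      rw [Real.norm_of_nonneg (hnn r s hs)]
  have hswap := integral_integral_swap hint
  have hl : ∫ r, ∫ s, f r s ∂ν ∂ν
      = Real.Gamma α * Real.Gamma (1 - α) * ∫ r in (0 : ℝ)..t, z r := by
    rw [intervalIntegral.integral_of_le ht.le, ← integral_const_mul]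
    refine integral_congr_ae ?_
    filter_upwards [hlt] with r hr
    rw [← (setIntegral_indicator_Ioi_sub_rpow hα hr.1 hr.2).2, ← integral_mul_const]
  have hr : ∫ s, ∫ r, f r s ∂ν ∂ν
      = Real.Gamma α * Real.Gamma (1 - α) * rlIntegral (-α) (rlIntegral (α - 1) z) t := by
    rw [rlIntegral, intervalIntegral.integral_of_le ht.le, smul_eq_mul, neg_neg, ← mul_assoc,
      show Real.Gamma α * Real.Gamma (1 - α) * (1 / Real.Gamma α) = Real.Gamma (1 - α) by
        field_simp, ← integral_const_mul]
    refine integral_congr_ae ?_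
    filter_upwards [hlt] with s hs
    have e : Ioc 0 t ∩ Iio s = Ioo 0 s := by
      ext x
      simp only [mem_inter_iff, mem_Ioc, mem_Iio, mem_Ioo]
      exact ⟨fun h => ⟨h.1.1, h.2⟩, fun h => ⟨⟨h.1, (h.2.trans hs.2).le⟩, h.2⟩⟩
    have e1 : (fun r => f r s) = (Iio s).indicator
        (fun r => (t - s) ^ (α - 1) * rlIntegrand (α - 1) z s r) := by
      funext r
      by_cases hrs : r < s
      · simp [f, indicator, hrs, rlIntegrand, mul_assoc]
      · simp [f, indicator, hrs]
    rw [e1, hν, setIntegral_indicator measurableSet_Iio, e, integral_const_mul, rlIntegrand,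
      rlIntegral, intervalIntegral.integral_of_le hs.1.le, integral_Ioc_eq_integral_Ioo,
      neg_sub, smul_eq_mul, smul_eq_mul, show -(-α + 1) = α - 1 by ring]
    field_simp
  rw [hl, hr] at hswap
  exact (mul_left_cancel₀ (by positivity) hswap).symm

theorem intervalIntegrable_rlIntegrand_of_continuousOn {h : ℝ → ℝ} {σ t : ℝ} (hσ : σ < 0)
    (ht : 0 ≤ t) (hc : ContinuousOn h (Icc 0 t)) :
    IntervalIntegrable (rlIntegrand σ h t) volume 0 t := by
  have h1 : IntervalIntegrable (fun s : ℝ => (t - s) ^ (-(σ + 1))) volume 0 t := by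
    have := (intervalIntegral.intervalIntegrable_rpow' (by linarith : -1 < -(σ + 1))
      (a := t) (b := 0)).comp_sub_left t
    simpa using this
  refine h1.mul_continuousOn ?_
  rwa [uIcc_of_le ht]

variable {z q : ℝ → ℝ} {α T : ℝ}

theorem rlIntegral_nonpos_of_rlDeriv_eq (hα : α ∈ Ioo (0 : ℝ) 1)
    (hz : ContinuousOn z (Ioi 0))
    (hi : ∀ t, 0 < t → IntervalIntegrable (rlIntegrand (α - 1) z t) volume 0 t)
    (hlim : Tendsto (rlIntegral (α - 1) z) (𝓝[>] 0) (𝓝 0))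
    (hc : ContinuousOn (rlIntegral (α - 1) z) (Ioi 0)) (hq : ∀ t ∈ Ioc 0 T, 0 < q t)
    (hd : ∀ t ∈ Ioc 0 T, HasDerivAt (rlIntegral (α - 1) z) (-(q t * z t)) t) :
    ∀ t ∈ Icc 0 T, rlIntegral (α - 1) z t ≤ 0 := by
  set W := rlIntegral (α - 1) z with hW
  -- The integral over the empty interval is `0`, which agrees with the assumed limit; hence `W` is
  -- continuous up to `0`.
  have hW0 : W 0 = 0 := by simp [hW, rlIntegral]
  have hWc : ContinuousOn W (Ici 0) := by
    intro t ht
    rcases eq_or_lt_of_le (show 0 ≤ t from ht) with rfl | h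
    · have : Tendsto W (𝓝[>] 0) (𝓝 (W 0)) := by rwa [hW0]
      exact continuousWithinAt_Ioi_iff_Ici.1 this
    · exact ((hc t h).continuousAt (Ioi_mem_nhds h)).continuousWithinAt
  intro t ht
  by_contra! hpos
  obtain ⟨t₀, ht₀, hmax⟩ := isCompact_Icc.exists_isMaxOn (nonempty_of_mem ht)
    (hWc.mono Icc_subset_Ici_self : ContinuousOn W (Icc 0 T))
  have hM : 0 < W t₀ := hpos.trans_le (hmax ht)
  have h0 : 0 < t₀ := by
    rcases eq_or_lt_of_le ht₀.1 with h | h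
    · rw [← h, hW0] at hM
      exact absurd hM (lt_irrefl _)
    · exact h
  have hcα : Icc 0 t₀ ⊆ Icc 0 T := Icc_subset_Icc le_rfl ht₀.2
  have hderiv := hd t₀ ⟨h0, ht₀.2⟩
  have hG := Real.Gamma_pos_of_pos (by linarith [hα.1] : 0 < 1 + α)
  -- Both pieces are explicit: `J^{-α} 1 = s^α / Γ(1 + α)` and `J^{-α} W = ∫ z`. Continuity of `z`
  -- at `t₀` is therefore enough.
  have hV : HasDerivAt (rlIntegral (-α) fun s => W t₀ - W s)
      (W t₀ * (1 / Real.Gamma (1 + α) * (α * t₀ ^ (α - 1))) - z t₀) t₀ := by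
    have hd1 : HasDerivAt (fun s : ℝ => W t₀ * (1 / Real.Gamma (1 + α) * s ^ α))
        (W t₀ * (1 / Real.Gamma (1 + α) * (α * t₀ ^ (α - 1)))) t₀ :=
      ((Real.hasDerivAt_rpow_const (Or.inl h0.ne')).const_mul _).const_mul _
    have hd2 : HasDerivAt (fun s : ℝ => ∫ r in (0 : ℝ)..s, z r) (z t₀) t₀ := by
      refine intervalIntegral.integral_hasDerivAt_right
        (intervalIntegrable_of_rlIntegrand ⟨by linarith [hα.1], by linarith [hα.2]⟩ h0
          (hi t₀ h0)) ?_ (hz.continuousAt (Ioi_mem_nhds h0))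
      exact hz.stronglyMeasurableAtFilter isOpen_Ioi t₀ h0
    refine (hd1.sub hd2).congr_of_eventuallyEq ?_
    filter_upwards [Ioi_mem_nhds h0] with s hs
    have hs0 : 0 < s := hs
    have i1 := intervalIntegrable_rlIntegrand_of_continuousOn (σ := -α) (t := s)
      (by linarith [hα.1]) hs0.le (continuousOn_const (c := W t₀))
    have i2 := intervalIntegrable_rlIntegrand_of_continuousOn (σ := -α) (t := s)
      (by linarith [hα.1]) hs0.le (hWc.mono Icc_subset_Ici_self)
    rw [rlIntegral_sub i1 i2, hW, rlIntegral_neg_rlIntegral_sub_one hα hs0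
      (intervalIntegrable_of_rlIntegrand ⟨by linarith [hα.1], by linarith [hα.2]⟩ hs0
          (hi s hs0))]
    have h1 := rlIntegral_rpow (σ := -α) (p := 0) (t := s) (by linarith [hα.1]) (by norm_num) hs0
    have h2 := rlIntegral_const_smul (rlIntegral (α - 1) z t₀) (fun s : ℝ => s ^ (0 : ℝ)) (-α) s
    rw [h1] at h2
    simp only [Real.rpow_zero, smul_eq_mul, mul_one, zero_add, Real.Gamma_one,
      sub_neg_eq_add] at h2
    rw [h2]
    simp
  obtain ⟨C, hC⟩ := exists_eventually_le_mul_sub (V := fun s => W t₀ - W s) (t := t₀)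
    ((differentiableAt_const _).sub hderiv.differentiableAt) (sub_self _)
  have hneg := deriv_rlIntegral_nonpos (σ := -α) ⟨by linarith [hα.2], by linarith [hα.1]⟩ h0
    (fun s hs => intervalIntegrable_rlIntegrand_of_continuousOn (by linarith [hα.1]) hs.1.le
      (continuousOn_const.sub (hWc.mono Icc_subset_Ici_self)))
    (fun s hs => sub_nonneg.2 (hmax (hcα ⟨hs.1.le, hs.2.le⟩))) hC hV
  have hpos' : 0 < W t₀ * (1 / Real.Gamma (1 + α) * (α * t₀ ^ (α - 1))) := by
    have := hα.1
    positivity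
  have hz0 : 0 < z t₀ := by linarith
  have hq0 := hq t₀ ⟨h0, ht₀.2⟩
  -- Left difference quotients at the maximum are nonnegative; only the left side is used, since
  -- `t₀` may equal `T`.
  have : 0 ≤ -(q t₀ * z t₀) := by
    refine ge_of_tendsto hderiv.tendsto_slope_zero_left ?_
    filter_upwards [Ioo_mem_nhdsLT (by linarith : -t₀ < 0)] with h hh
    have h1 : W (t₀ + h) ≤ W t₀ := hmax (hcα ⟨by linarith [hh.1], by linarith [hh.2]⟩)
    rw [smul_eq_mul]
    exact mul_nonneg_of_nonpos_of_nonpos (inv_nonpos.2 hh.2.le) (by linarith)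
  nlinarith [mul_pos hq0 hz0]

theorem eq_zero_of_rlDeriv_eq (hα : α ∈ Ioo (0 : ℝ) 1) (hz : ContinuousOn z (Ioi 0))
    (hi : ∀ t, 0 < t → IntervalIntegrable (rlIntegrand (α - 1) z t) volume 0 t)
    (hlim : Tendsto (rlIntegral (α - 1) z) (𝓝[>] 0) (𝓝 0))
    (hc : ContinuousOn (rlIntegral (α - 1) z) (Ioi 0)) (hq : ∀ t ∈ Ioc 0 T, 0 < q t)
    (hd : ∀ t ∈ Ioc 0 T, HasDerivAt (rlIntegral (α - 1) z) (-(q t * z t)) t) :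
    ∀ t ∈ Ioc 0 T, z t = 0 := by
  have hle := rlIntegral_nonpos_of_rlDeriv_eq hα hz hi hlim hc hq hd
  have hneg : rlIntegral (α - 1) (fun s => -z s) = fun t => -rlIntegral (α - 1) z t := by
    funext t
    simpa using rlIntegral_const_smul (-1) z (α - 1) t
  have hge := rlIntegral_nonpos_of_rlDeriv_eq (z := fun s => -z s) (q := q) (T := T) hα hz.neg
    (fun t ht => by
      have := (hi t ht).neg
      refine this.congr fun s _ => ?_
      simp [rlIntegrand])
    (by rw [hneg]; simpa using hlim.neg) (by rw [hneg]; exact hc.neg) hq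
    (fun t ht => by
      rw [hneg, mul_neg]
      exact (hd t ht).neg)
  rw [hneg] at hge
  have hW : ∀ t ∈ Icc 0 T, rlIntegral (α - 1) z t = 0 := fun t ht => by
    have := hge t ht
    simp only at this
    linarith [hle t ht]
  intro t ht
  -- `W` is known to vanish only up to `T`, so at `t = T` just the left derivative is available; it
  -- determines the derivative.
  have h1 : HasDerivWithinAt (rlIntegral (α - 1) z) 0 (Icc 0 t) t :=
    (hasDerivWithinAt_const t (Icc 0 t) (0 : ℝ)).congr
      (fun s hs => hW s ⟨hs.1, hs.2.trans ht.2⟩) (hW t ⟨ht.1.le, ht.2⟩)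
  have h2 := (uniqueDiffOn_Icc ht.1 t ⟨ht.1.le, le_rfl⟩).eq_deriv _
    (hd t ht).hasDerivWithinAt h1
  rcases mul_eq_zero.1 (neg_eq_zero.1 h2) with h | h
  · exact absurd h (hq t ht).ne'
  · exact h

end Uniqueness

/-! ### Termwise differentiation of everywhere convergent power series. -/

section EntireSeries

theorem summable_natCast_mul_pow {a : ℕ → ℝ} (ha : ∀ r : ℝ, Summable fun n => |a n| * r ^ n)
    (r : ℝ) : Summable fun n : ℕ => |a n| * (n * r ^ (n - 1)) := by
  set R := |r| + 1 with hR
  have hR0 : 0 < R := by positivity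
  refine Summable.of_norm_bounded (ha (2 * R)) fun n => ?_
  have h1 : (n : ℝ) ≤ 2 ^ n := by exact_mod_cast (Nat.lt_two_pow_self).le
  have h2 : |r| ^ (n - 1) ≤ R ^ n :=
    (pow_le_pow_left₀ (abs_nonneg r) (by linarith) _).trans
      (pow_le_pow_right₀ (by linarith [abs_nonneg r]) (Nat.sub_le _ _))
  rw [norm_mul, norm_mul, norm_pow, Real.norm_eq_abs, Real.norm_eq_abs, Real.norm_eq_abs, abs_abs,
    Nat.abs_cast, mul_pow]
  gcongr

theorem summable_mul_pow {a : ℕ → ℝ} (ha : ∀ r : ℝ, Summable fun n => |a n| * r ^ n) (x : ℝ) :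
    Summable fun n => a n * x ^ n := by
  refine Summable.of_norm ?_
  simpa [abs_mul, abs_pow] using ha |x|

theorem hasDerivAt_tsum_mul_pow {a : ℕ → ℝ} (ha : ∀ r : ℝ, Summable fun n => |a n| * r ^ n)
    (x : ℝ) : HasDerivAt (fun y => ∑' n, a n * y ^ n) (∑' n, a n * (n * x ^ (n - 1))) x := by
  refine hasDerivAt_tsum_of_isPreconnected (g := fun n y => a n * y ^ n)
    (g' := fun n y => a n * (n * y ^ (n - 1)))
    (summable_natCast_mul_pow ha (|x| + 1)) (t := Ioo (-(|x| + 1)) (|x| + 1))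
    isOpen_Ioo isPreconnected_Ioo (fun n y _ => (hasDerivAt_pow n y).const_mul _)
    (fun n y hy => ?_) (y₀ := x) ?_ (summable_mul_pow ha x) ?_
  · rw [norm_mul, norm_mul, norm_pow, Real.norm_eq_abs, Real.norm_eq_abs, Real.norm_eq_abs,
      Nat.abs_cast]
    have : |y| ≤ |x| + 1 := (abs_lt.2 hy).le
    gcongr
  all_goals exact abs_lt.1 (by linarith)

theorem mul_tsum_natCast_mul_pow {a : ℕ → ℝ} (x : ℝ) :
    x * ∑' n : ℕ, a n * (n * x ^ (n - 1)) = ∑' n : ℕ, n * (a n * x ^ n) := by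
  rw [← tsum_mul_left]
  refine tsum_congr fun n => ?_
  rcases n with _ | n
  · simp
  · simp only [Nat.add_sub_cancel, pow_succ]
    ring

theorem summable_natCast_mul_mul_pow {a : ℕ → ℝ}
    (ha : ∀ r : ℝ, Summable fun n => |a n| * r ^ n) (x : ℝ) :
    Summable fun n : ℕ => n * (a n * x ^ n) := by
  have h : Summable fun n : ℕ => a n * (n * x ^ (n - 1)) := by
    refine Summable.of_norm ?_
    simpa [abs_mul, abs_pow] using summable_natCast_mul_pow ha |x|
  refine (h.mul_left x).congr fun n => ?_
  rcases n with _ | n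
  · simp
  · simp only [Nat.add_sub_cancel, pow_succ]
    ring

end EntireSeries

/-! ### The Kilbas–Saigo function and the scalar equation. -/

section KilbasSaigo

variable {α β μ : ℝ}

/-- The exponent `n (α + β) + μ + 1` of the `n`-th term of `J^{α-1}` of the relaxation function. -/
def relaxationExponent (α β μ : ℝ) (n : ℕ) : ℝ := n * (α + β) + μ + 1

/-- The coefficients `c_n` with `m = 1 + β / α`, `l = 1 + (β + μ) / α`. -/
def relaxationCoeff (α β μ : ℝ) (n : ℕ) : ℝ :=
  kilbasSaigoCoeff α (1 + β / α) (1 + (β + μ) / α) n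

/-- The coefficients of `t ^ (-(μ + 1))` times `J^{α-1}` of the relaxation function. -/
def relaxationIntegralCoeff (α β μ : ℝ) (n : ℕ) : ℝ :=
  relaxationCoeff α β μ n * (Real.Gamma (relaxationExponent α β μ n + α)
    / Real.Gamma (relaxationExponent α β μ n + 1))

theorem relaxationExponent_nonneg (hβ : -α < β) (hμ : -1 ≤ μ) (n : ℕ) :
    0 ≤ relaxationExponent α β μ n := by
  have : 0 ≤ n * (α + β) := mul_nonneg n.cast_nonneg (by linarith)
  unfold relaxationExponent
  linarith

theorem relaxationExponent_succ_pos (hβ : -α < β) (hμ : -1 ≤ μ) (n : ℕ) :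
    0 < relaxationExponent α β μ (n + 1) := by
  have := relaxationExponent_nonneg hβ hμ n
  unfold relaxationExponent at *
  push_cast
  linarith

theorem tendsto_relaxationExponent (hβ : -α < β) :
    Tendsto (relaxationExponent α β μ) atTop atTop := by
  have h : Tendsto (fun n : ℕ => (n : ℝ) * (α + β)) atTop atTop :=
    tendsto_natCast_atTop_atTop.atTop_mul_const (by linarith)
  have := tendsto_atTop_add_const_right _ (μ + 1) h
  refine this.congr fun n => ?_
  unfold relaxationExponent
  ring

theorem relaxationCoeff_zero : relaxationCoeff α β μ 0 = 1 := by
  simp [relaxationCoeff, kilbasSaigoCoeff]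

theorem relaxationCoeff_succ (hα : 0 < α) (n : ℕ) :
    relaxationCoeff α β μ (n + 1) = relaxationCoeff α β μ n *
      (Real.Gamma (relaxationExponent α β μ (n + 1))
        / Real.Gamma (relaxationExponent α β μ (n + 1) + α)) := by
  have h1 : α * (n * (1 + β / α) + (1 + (β + μ) / α)) + 1 = relaxationExponent α β μ (n + 1) := by
    unfold relaxationExponent
    push_cast
    field_simp
    ring
  have h2 : α * (n * (1 + β / α) + (1 + (β + μ) / α) + 1) + 1
      = relaxationExponent α β μ (n + 1) + α := by
    rw [← h1]
    ring
  rw [relaxationCoeff, kilbasSaigoCoeff, Finset.prod_range_succ, h1, h2]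
  rfl

theorem relaxationCoeff_pos (hα : 0 < α) (hβ : -α < β) (hμ : -1 ≤ μ) (n : ℕ) :
    0 < relaxationCoeff α β μ n := by
  induction n with
  | zero => simp [relaxationCoeff_zero]
  | succ n ih =>
    rw [relaxationCoeff_succ hα]
    have h := relaxationExponent_succ_pos hβ hμ n
    have h1 := Real.Gamma_pos_of_pos h
    have h2 := Real.Gamma_pos_of_pos (add_pos h hα)
    positivity

theorem summable_relaxationCoeff (hα : α ∈ Ioo (0 : ℝ) 1) (hβ : -α < β) (hμ : -1 ≤ μ) (r : ℝ) :
    Summable fun n => |relaxationCoeff α β μ n| * r ^ n := by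
  -- The ratio test needs nonzero terms.
  rcases eq_or_ne r 0 with rfl | hr
  · refine summable_of_ne_finset_zero (s := {0}) fun n hn => ?_
    simp [Finset.mem_singleton.not.1 hn]
  have hc := relaxationCoeff_pos hα.1 hβ hμ
  refine summable_of_ratio_test_tendsto_lt_one one_pos
    (Eventually.of_forall fun n => mul_ne_zero (abs_ne_zero.2 (hc n).ne') (pow_ne_zero _ hr)) ?_
  have h1 := ((tendsto_Gamma_div_Gamma_add hα).comp
    ((tendsto_relaxationExponent (μ := μ) hβ).comp (tendsto_add_atTop_nat 1))).mul_const |r|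
  rw [zero_mul] at h1
  refine h1.congr fun n => ?_
  have h := relaxationExponent_succ_pos hβ hμ n
  have h1 := Real.Gamma_pos_of_pos h
  have h2 := Real.Gamma_pos_of_pos (add_pos h hα.1)
  have h3 := hc n
  have h4 : 0 < |r| := abs_pos.2 hr
  simp only [Function.comp_apply, norm_mul, norm_pow, Real.norm_eq_abs, abs_abs]
  rw [relaxationCoeff_succ hα.1, abs_of_pos (mul_pos h3 (div_pos h1 h2)), abs_of_pos h3, pow_succ]
  field_simp

/-- The extra factor `Γ(e + α) / Γ(e + 1)` tends to `0` as the exponent `e` grows, since `α < 1`; in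
particular it is bounded. -/
theorem summable_relaxationIntegralCoeff (hα : α ∈ Ioo (0 : ℝ) 1) (hβ : -α < β) (hμ : -1 ≤ μ)
    (r : ℝ) : Summable fun n => |relaxationIntegralCoeff α β μ n| * r ^ n := by
  have h1 := (tendsto_Gamma_div_Gamma_add (a := 1 - α) ⟨by linarith [hα.2], by linarith [hα.1]⟩
    ).comp (tendsto_atTop_add_const_right _ α (tendsto_relaxationExponent (μ := μ) hβ))
  refine summable_of_isBigO_nat (summable_relaxationCoeff hα hβ hμ |r|).norm ?_
  have h2 := (Asymptotics.isBigO_refl (fun n => |relaxationCoeff α β μ n| * |r| ^ n) atTop).mul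
    (h1.isBigO_one ℝ)
  refine Asymptotics.isBigO_norm_left.1 (h2.norm_norm.congr (fun n => ?_) (fun n => ?_))
  · simp only [Function.comp_apply, relaxationIntegralCoeff, norm_mul, norm_pow,
      Real.norm_eq_abs, abs_abs, abs_mul]
    rw [show relaxationExponent α β μ n + α + (1 - α) = relaxationExponent α β μ n + 1 by ring]
    ring
  · simp

/-- `E_{α,m,l}(-x)` with `m = 1 + β / α`, `l = 1 + (β + μ) / α`. -/
def relaxationProfile (α β μ x : ℝ) : ℝ :=
  kilbasSaigo α (1 + β / α) (1 + (β + μ) / α) (-x)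

/-- The function `t ^ (α + μ) E_{α,m,l}(-lam t ^ (α + β))`, which solves the scalar relaxation
equation `∂_t^α y + lam t ^ β y = Γ(α + μ + 1) / Γ(μ + 1) t ^ μ`. -/
def relaxation (α β μ lam t : ℝ) : ℝ :=
  t ^ (α + μ) * relaxationProfile α β μ (lam * t ^ (α + β))

theorem relaxationProfile_eq_tsum (x : ℝ) :
    relaxationProfile α β μ x = ∑' n, relaxationCoeff α β μ n * (-x) ^ n := rfl

theorem relaxationProfile_zero : relaxationProfile α β μ 0 = 1 := by
  rw [relaxationProfile_eq_tsum, tsum_eq_single 0 (by simp +contextual)]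
  simp [relaxationCoeff_zero]

theorem hasDerivAt_relaxationProfile (hα : α ∈ Ioo (0 : ℝ) 1) (hβ : -α < β) (hμ : -1 ≤ μ)
    (x : ℝ) : HasDerivAt (relaxationProfile α β μ)
      (-∑' n : ℕ, relaxationCoeff α β μ n * (n * (-x) ^ (n - 1))) x := by
  have h := (hasDerivAt_tsum_mul_pow (summable_relaxationCoeff hα hβ hμ) (-x)).comp x
    (hasDerivAt_neg x)
  rw [mul_neg_one] at h
  exact h

theorem differentiable_relaxationProfile (hα : α ∈ Ioo (0 : ℝ) 1) (hβ : -α < β) (hμ : -1 ≤ μ) :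
    Differentiable ℝ (relaxationProfile α β μ) :=
  fun x => (hasDerivAt_relaxationProfile hα hβ hμ x).differentiableAt

theorem differentiableAt_relaxation (hα : α ∈ Ioo (0 : ℝ) 1) (hβ : -α < β) (hμ : -1 ≤ μ)
    (lam : ℝ) {t : ℝ} (ht : 0 < t) : DifferentiableAt ℝ (relaxation α β μ lam) t := by
  have h1 : DifferentiableAt ℝ (fun s : ℝ => lam * s ^ (α + β)) t :=
    (Real.differentiableAt_rpow_const_of_ne _ ht.ne').const_mul _
  exact (Real.differentiableAt_rpow_const_of_ne _ ht.ne').mul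
    ((differentiable_relaxationProfile hα hβ hμ _).comp t h1)

theorem continuousOn_relaxation (hα : α ∈ Ioo (0 : ℝ) 1) (hβ : -α < β) (hμ : -1 ≤ μ)
    (lam : ℝ) : ContinuousOn (relaxation α β μ lam) (Ioi 0) :=
  fun _ ht => (differentiableAt_relaxation hα hβ hμ lam ht).continuousAt.continuousWithinAt

theorem intervalIntegrable_rlIntegrand_relaxation (hα : α ∈ Ioo (0 : ℝ) 1) (hβ : -α < β)
    (hμ : -1 ≤ μ) (lam : ℝ) {t : ℝ} (ht : 0 < t) :
    IntervalIntegrable (rlIntegrand (α - 1) (relaxation α β μ lam) t) volume 0 t := by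
  have h1 := intervalIntegrable_rlIntegrand_rpow (σ := α - 1) (p := α + μ) (by linarith [hα.2])
    (by linarith [hα.1]) ht
  have h2 : Continuous fun s : ℝ => relaxationProfile α β μ (lam * s ^ (α + β)) :=
    (differentiable_relaxationProfile hα hβ hμ).continuous.comp
      (continuous_const.mul (Real.continuous_rpow_const (by linarith)))
  refine (h1.mul_continuousOn h2.continuousOn).congr fun s _ => ?_
  simp only [rlIntegrand, relaxation, smul_eq_mul]
  ring

/-- Each power is integrated by the Beta formula. The exchange of sum and integral is legitimate
because the integrals of the absolute values are summable. -/
theorem rlIntegral_relaxation (hα : α ∈ Ioo (0 : ℝ) 1) (hβ : -α < β) (hμ : -1 ≤ μ)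
    (lam : ℝ) {t : ℝ} (ht : 0 < t) :
    rlIntegral (α - 1) (relaxation α β μ lam) t
      = t ^ (μ + 1) * ∑' n, relaxationIntegralCoeff α β μ n * (-(lam * t ^ (α + β))) ^ n := by
  set c := relaxationCoeff α β μ with hc
  set p : ℕ → ℝ := fun n => relaxationExponent α β μ n + α - 1 with hp
  have hp1 : ∀ n, -1 < p n := fun n => by
    have := relaxationExponent_nonneg hβ hμ n
    simp only [p]
    linarith [hα.1]
  have hσ : α - 1 < 0 := by linarith [hα.2]
  have hG := Real.Gamma_pos_of_pos (neg_pos.2 hσ)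
  set F : ℕ → ℝ → ℝ := fun n s =>
    c n * (-lam) ^ n * rlIntegrand (α - 1) (fun s : ℝ => s ^ p n) t s with hF
  have hFi : ∀ n, IntegrableOn (F n) (Ioc 0 t) := fun n => by
    rw [← intervalIntegrable_iff_integrableOn_Ioc_of_le ht.le]
    exact (intervalIntegrable_rlIntegrand_rpow hσ (hp1 n) ht).const_mul _
  have hI : ∀ n, ∫ s in Ioc 0 t, rlIntegrand (α - 1) (fun s : ℝ => s ^ p n) t s =
      Real.Gamma (-(α - 1)) * (t ^ (μ + 1) * (Real.Gamma (relaxationExponent α β μ n + α)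
        / Real.Gamma (relaxationExponent α β μ n + 1) * (t ^ (α + β)) ^ n)) := fun n => by
    have h := rlIntegral_rpow hσ (hp1 n) ht
    rw [rlIntegral, intervalIntegral.integral_of_le ht.le, smul_eq_mul] at h
    have h2 : t ^ (p n - (α - 1)) = t ^ (μ + 1) * (t ^ (α + β)) ^ n := by
      rw [← Real.rpow_natCast, ← Real.rpow_mul ht.le, ← Real.rpow_add ht]
      congr 1
      simp only [p, relaxationExponent]
      ring
    rw [h2, show p n + 1 = relaxationExponent α β μ n + α by simp only [p]; ring,
      show relaxationExponent α β μ n + α - (α - 1) = relaxationExponent α β μ n + 1 by ring] at h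
    rw [← mul_assoc (t ^ (μ + 1)), mul_comm (t ^ (μ + 1)), mul_assoc, ← h]
    field_simp
  have hFI : ∀ n, ∫ s in Ioc 0 t, F n s = Real.Gamma (-(α - 1)) * (t ^ (μ + 1) *
      (relaxationIntegralCoeff α β μ n * (-(lam * t ^ (α + β))) ^ n)) := fun n => by
    rw [hF]
    simp only
    rw [integral_const_mul, hI, relaxationIntegralCoeff, ← neg_mul, mul_pow]
    ring
  have hFn : ∀ n, ∫ s in Ioc 0 t, ‖F n s‖ = Real.Gamma (-(α - 1)) * (t ^ (μ + 1) *
      (|relaxationIntegralCoeff α β μ n| * |lam * t ^ (α + β)| ^ n)) := fun n => by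
    have h1 : ∫ s in Ioc 0 t, ‖F n s‖ = ∫ s in Ioc 0 t, |c n * (-lam) ^ n| *
        rlIntegrand (α - 1) (fun s : ℝ => s ^ p n) t s := by
      refine setIntegral_congr_fun measurableSet_Ioc fun s hs => ?_
      have h2 : 0 ≤ rlIntegrand (α - 1) (fun s : ℝ => s ^ p n) t s :=
        mul_nonneg (Real.rpow_nonneg (by linarith [hs.2]) _) (Real.rpow_nonneg hs.1.le _)
      simp only [F]
      rw [norm_mul, Real.norm_of_nonneg h2, Real.norm_eq_abs]
    have e0 := relaxationExponent_nonneg hβ hμ n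
    have e1 := Real.Gamma_pos_of_pos (by linarith [hα.1] : 0 < relaxationExponent α β μ n + α)
    have e2 := Real.Gamma_pos_of_pos (by linarith : 0 < relaxationExponent α β μ n + 1)
    rw [h1, integral_const_mul, hI, relaxationIntegralCoeff, abs_mul, abs_mul, abs_pow, abs_neg,
      abs_mul lam, abs_of_pos (Real.rpow_pos_of_pos ht (α + β)), abs_of_pos (div_pos e1 e2),
      mul_pow]
    ring
  have hsum := hasSum_integral_of_summable_integral_norm hFi (by
    simp_rw [hFn]
    exact ((summable_relaxationIntegralCoeff hα hβ hμ _).mul_left _).mul_left _)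
  have hY : ∫ s in Ioc 0 t, ∑' n, F n s
      = ∫ s in Ioc 0 t, rlIntegrand (α - 1) (relaxation α β μ lam) t s := by
    refine setIntegral_congr_fun measurableSet_Ioc fun s hs => ?_
    have hs0 : 0 < s := hs.1
    simp only [F, rlIntegrand, relaxation, relaxationProfile_eq_tsum, smul_eq_mul]
    rw [← tsum_mul_left, ← tsum_mul_left]
    refine tsum_congr fun n => ?_
    have : s ^ p n = s ^ (α + μ) * (s ^ (α + β)) ^ n := by
      rw [← Real.rpow_natCast, ← Real.rpow_mul hs0.le, ← Real.rpow_add hs0]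
      congr 1
      simp only [p, relaxationExponent]
      ring
    rw [this, ← neg_mul, mul_pow]
    ring
  have h := hsum.tsum_eq
  simp_rw [hFI] at h
  rw [hY, tsum_mul_left, tsum_mul_left] at h
  rw [rlIntegral, intervalIntegral.integral_of_le ht.le, ← h, smul_eq_mul]
  field_simp

/-- The recursion behind the differential equation: differentiating the term of index `n + 1` of
`J^{α-1} y` reproduces the term of index `n` of `y`, up to the factor `-λ t^β`. -/
theorem relaxationExponent_mul_integralCoeff (hα : 0 < α) (hβ : -α < β) (hμ : -1 ≤ μ) (n : ℕ) :
    relaxationExponent α β μ (n + 1) * relaxationIntegralCoeff α β μ (n + 1)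
      = relaxationCoeff α β μ n := by
  have h := relaxationExponent_succ_pos hβ hμ n
  have h1 := Real.Gamma_pos_of_pos h
  have h2 := Real.Gamma_pos_of_pos (add_pos h hα)
  rw [relaxationIntegralCoeff, relaxationCoeff_succ hα, Real.Gamma_add_one h.ne']
  field_simp

theorem relaxationExponent_zero_mul_integralCoeff :
    relaxationExponent α β μ 0 * relaxationIntegralCoeff α β μ 0
      = Real.Gamma (α + μ + 1) / Real.Gamma (μ + 1) := by
  have h : relaxationExponent α β μ 0 = μ + 1 := by simp [relaxationExponent]
  rw [relaxationIntegralCoeff, relaxationCoeff_zero, h, show μ + 1 + α = α + μ + 1 by ring]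
  -- For `μ = -1` both sides are `0`: the exponent vanishes, and `Real.Gamma 0 = 0` makes the
  -- quotient `0`.
  rcases eq_or_ne (μ + 1) 0 with h0 | h0
  · simp [h0]
  · rw [Real.Gamma_add_one h0, one_mul]
    field_simp

theorem hasDerivAt_rlIntegral_relaxation (hα : α ∈ Ioo (0 : ℝ) 1) (hβ : -α < β) (hμ : -1 ≤ μ)
    (lam : ℝ) {t : ℝ} (ht : 0 < t) :
    HasDerivAt (rlIntegral (α - 1) (relaxation α β μ lam))
      (t ^ μ * (Real.Gamma (α + μ + 1) / Real.Gamma (μ + 1))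
        - lam * t ^ β * relaxation α β μ lam t) t := by
  set d := relaxationIntegralCoeff α β μ with hd
  have hs := summable_relaxationIntegralCoeff hα hβ hμ
  set x := -(lam * t ^ (α + β)) with hx
  have h1 : HasDerivAt (fun s : ℝ => -(lam * s ^ (α + β)))
      (-(lam * ((α + β) * t ^ (α + β - 1)))) t :=
    ((Real.hasDerivAt_rpow_const (Or.inl ht.ne')).const_mul _).neg
  have h2 : HasDerivAt (fun s : ℝ => ∑' n, d n * (-(lam * s ^ (α + β))) ^ n)
      ((∑' n : ℕ, d n * (n * x ^ (n - 1))) * -(lam * ((α + β) * t ^ (α + β - 1)))) t :=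
    HasDerivAt.comp (h₂ := fun y => ∑' n, d n * y ^ n) t (hasDerivAt_tsum_mul_pow hs x) h1
  have h3 : HasDerivAt (fun s : ℝ => s ^ (μ + 1) * ∑' n, d n * (-(lam * s ^ (α + β))) ^ n)
      ((μ + 1) * t ^ (μ + 1 - 1) * (∑' n, d n * x ^ n) + t ^ (μ + 1) *
        ((∑' n : ℕ, d n * (n * x ^ (n - 1))) * -(lam * ((α + β) * t ^ (α + β - 1))))) t :=
    (Real.hasDerivAt_rpow_const (Or.inl ht.ne')).mul h2
  -- Multiplying each term by its exponent is the action of `t d/dt` on the series for `J^{α-1} y`.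
  have h4 : ∑' n, relaxationExponent α β μ n * (d n * x ^ n)
      = (α + β) * (x * ∑' n : ℕ, d n * (n * x ^ (n - 1))) + (μ + 1) * ∑' n, d n * x ^ n := by
    rw [mul_tsum_natCast_mul_pow, ← tsum_mul_left, ← tsum_mul_left, ← Summable.tsum_add
      ((summable_natCast_mul_mul_pow hs x).mul_left _) ((summable_mul_pow hs x).mul_left _)]
    refine tsum_congr fun n => ?_
    rw [relaxationExponent]
    ring
  have h5 : Summable fun n => relaxationExponent α β μ n * (d n * x ^ n) := by
    refine (((summable_natCast_mul_mul_pow hs x).mul_left (α + β)).add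
      ((summable_mul_pow hs x).mul_left (μ + 1))).congr fun n => ?_
    rw [relaxationExponent]
    ring
  -- The term `n = 0` is the source; shifting the index in the rest recovers the original function.
  have h6 : ∑' n, relaxationExponent α β μ n * (d n * x ^ n)
      = Real.Gamma (α + μ + 1) / Real.Gamma (μ + 1)
        + x * relaxationProfile α β μ (lam * t ^ (α + β)) := by
    rw [h5.tsum_eq_zero_add, relaxationProfile_eq_tsum, ← tsum_mul_left,
      ← relaxationExponent_zero_mul_integralCoeff (β := β)]
    congr 1
    · simp [hd]
    · refine tsum_congr fun n => ?_
      rw [← relaxationExponent_mul_integralCoeff hα.1 hβ hμ, pow_succ]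
      ring
  refine (h3.congr_of_eventuallyEq ?_).congr_deriv ?_
  · filter_upwards [Ioi_mem_nhds ht] with s hs0
    exact rlIntegral_relaxation hα hβ hμ lam hs0
  · have e1 : t ^ (μ + 1) = t ^ μ * t := Real.rpow_add_one ht.ne' _
    have e2 : t * t ^ (α + β - 1) = t ^ (α + β) := by
      rw [Real.rpow_sub_one ht.ne']
      field_simp
    have e3 : t ^ β * t ^ (α + μ) = t ^ μ * t ^ (α + β) := by
      rw [← Real.rpow_add ht, ← Real.rpow_add ht]
      congr 1
      ring
    have e4 : lam * t ^ β * relaxation α β μ lam t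
        = -(t ^ μ * (x * relaxationProfile α β μ (lam * t ^ (α + β)))) := by
      rw [relaxation, ← mul_assoc, mul_assoc lam, e3, hx]
      ring
    rw [e4, sub_neg_eq_add, ← mul_add, ← h6, h4, e1, add_sub_cancel_right, hx, ← e2]
    ring

theorem tendsto_rlIntegral_relaxation (hα : α ∈ Ioo (0 : ℝ) 1) (hβ : -α < β) (hμ : -1 ≤ μ)
    (lam : ℝ) : Tendsto (rlIntegral (α - 1) (relaxation α β μ lam)) (𝓝[>] 0)
      (𝓝 ((0 : ℝ) ^ (μ + 1) * (Real.Gamma (α + μ + 1) / Real.Gamma (μ + 2)))) := by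
  have hs := summable_relaxationIntegralCoeff hα hβ hμ
  have h1 : Tendsto (fun t : ℝ => t ^ (μ + 1)) (𝓝 0) (𝓝 ((0 : ℝ) ^ (μ + 1))) :=
    (Real.continuous_rpow_const (by linarith)).tendsto 0
  have h2 : Continuous fun t : ℝ =>
      ∑' n, relaxationIntegralCoeff α β μ n * (-(lam * t ^ (α + β))) ^ n := by
    have : Continuous fun y : ℝ => ∑' n, relaxationIntegralCoeff α β μ n * y ^ n :=
      continuous_iff_continuousAt.2 fun y => (hasDerivAt_tsum_mul_pow hs y).continuousAt
    exact this.comp (continuous_const.mul (Real.continuous_rpow_const (by linarith))).neg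
  have h3 := h1.mul (h2.tendsto 0)
  have h4 : ∑' n, relaxationIntegralCoeff α β μ n * (-(lam * (0 : ℝ) ^ (α + β))) ^ n
      = Real.Gamma (α + μ + 1) / Real.Gamma (μ + 2) := by
    rw [Real.zero_rpow (by linarith : α + β ≠ 0), tsum_eq_single 0 (by simp +contextual)]
    simp only [relaxationIntegralCoeff, relaxationCoeff_zero, relaxationExponent]
    rw [pow_zero, mul_one, one_mul]
    congr 2 <;> push_cast <;> ring
  rw [h4] at h3
  refine (h3.mono_left nhdsWithin_le_nhds).congr' ?_
  filter_upwards [self_mem_nhdsWithin] with t ht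
  exact (rlIntegral_relaxation hα hβ hμ lam ht).symm

end KilbasSaigo

/-! ### Comparison principle. -/

section Comparison

theorem exists_first_zero {w : ℝ → ℝ} (hw : ContinuousOn w (Ioi 0))
    (h0 : ∀ᶠ s in 𝓝[>] 0, 0 < w s) {t₁ : ℝ} (ht₁ : 0 < t₁) (hle : w t₁ ≤ 0) :
    ∃ t₀, 0 < t₀ ∧ w t₀ = 0 ∧ ∀ s ∈ Ioo 0 t₀, 0 < w s := by
  obtain ⟨δ, hδ, hpos⟩ := mem_nhdsGT_iff_exists_Ioo_subset.1 h0
  have hδ0 : 0 < δ := hδ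
  have hδt : δ ≤ t₁ := by
    by_contra! h
    exact absurd (hpos ⟨ht₁, h⟩ : 0 < w t₁) hle.not_gt
  -- Starting at `δ / 2` keeps the compact set away from `0`, where `w` need not be continuous.
  have hsub : Icc (δ / 2) t₁ ⊆ Ioi 0 := fun s hs => (half_pos hδ0).trans_le hs.1
  have hcl : IsCompact (Icc (δ / 2) t₁ ∩ w ⁻¹' Iic 0) :=
    isCompact_Icc.of_isClosed_subset
      ((hw.mono hsub).preimage_isClosed_of_isClosed isClosed_Icc isClosed_Iic) inter_subset_left
  obtain ⟨t₀, ht₀, hmin⟩ := hcl.exists_isLeast ⟨t₁, ⟨by linarith, le_rfl⟩, hle⟩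
  have hpos0 : 0 < t₀ := hsub ht₀.1
  have hlt : ∀ s ∈ Ioo 0 t₀, 0 < w s := fun s hs => by
    rcases lt_or_ge s δ with h | h
    · exact hpos ⟨hs.1, h⟩
    · by_contra! hn
      exact absurd (hmin ⟨⟨by linarith, hs.2.le.trans ht₀.1.2⟩, hn⟩) hs.2.not_ge
  refine ⟨t₀, hpos0, le_antisymm ht₀.2 ?_, hlt⟩
  refine ge_of_tendsto (((hw.continuousAt (Ioi_mem_nhds hpos0)).tendsto).mono_left
    (nhdsWithin_le_nhds (s := Iio t₀))) ?_
  filter_upwards [Ioo_mem_nhdsLT hpos0] with s hs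
  exact (hlt s hs).le

/-- At a first zero `w` is positive on the left and vanishes at a linear rate, so the extremum
principle contradicts the sign assumed there. -/
theorem pos_of_rlDeriv_nonneg_at_zeros {w D : ℝ → ℝ} {α : ℝ} (hα : α ∈ Ioo (0 : ℝ) 1)
    (hw : ∀ t, 0 < t → DifferentiableAt ℝ w t)
    (hi : ∀ t, 0 < t → IntervalIntegrable (rlIntegrand (α - 1) w t) volume 0 t)
    (hD : ∀ t, 0 < t → HasDerivAt (rlIntegral (α - 1) w) (D t) t)
    (h0 : ∀ᶠ s in 𝓝[>] 0, 0 < w s) (hz : ∀ t, 0 < t → w t = 0 → 0 ≤ D t) {t : ℝ} (ht : 0 < t) :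
    0 < w t := by
  by_contra! hle
  obtain ⟨t₀, ht₀, hw0, hpos⟩ := exists_first_zero
    (fun s hs => (hw s hs).continuousAt.continuousWithinAt) h0 ht hle
  obtain ⟨C, hC⟩ := exists_eventually_le_mul_sub (hw t₀ ht₀) hw0
  have := deriv_rlIntegral_neg (σ := α - 1) ⟨by linarith [hα.1], by linarith [hα.2]⟩ ht₀
    (fun s hs => hi s hs.1) hpos hC (hD t₀ ht₀)
  exact absurd (hz t₀ ht₀ hw0) this.not_ge

end Comparison

/-! ### Bounds on the scalar solutions, uniform in the eigenvalue. -/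

section RelaxationBounds

variable {α β μ : ℝ}

theorem Gamma_div_Gamma_nonneg (hα : 0 < α) (hμ : -1 ≤ μ) :
    0 ≤ Real.Gamma (α + μ + 1) / Real.Gamma (μ + 1) :=
  div_nonneg (Real.Gamma_nonneg_of_nonneg (by linarith)) (Real.Gamma_nonneg_of_nonneg (by linarith))

theorem tendsto_rpow_add_nhdsGT_zero (hβ : -α < β) :
    Tendsto (fun s : ℝ => s ^ (α + β)) (𝓝[>] 0) (𝓝[>] 0) := by
  refine tendsto_nhdsWithin_iff.2 ⟨?_, ?_⟩
  · have := (Real.continuous_rpow_const (by linarith : 0 ≤ α + β)).tendsto 0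
    rw [Real.zero_rpow (by linarith)] at this
    exact this.mono_left nhdsWithin_le_nhds
  · filter_upwards [self_mem_nhdsWithin] with s hs
    exact Real.rpow_pos_of_pos hs _

theorem relaxationProfile_pos (hα : α ∈ Ioo (0 : ℝ) 1) (hβ : -α < β) (hμ : -1 ≤ μ) {x : ℝ}
    (hx : 0 ≤ x) : 0 < relaxationProfile α β μ x := by
  rcases eq_or_lt_of_le hx with rfl | hx
  · rw [relaxationProfile_zero]
    exact one_pos
  have key := pos_of_rlDeriv_nonneg_at_zeros (w := relaxation α β μ x) hα
    (fun t ht => differentiableAt_relaxation hα hβ hμ x ht)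
    (fun t ht => intervalIntegrable_rlIntegrand_relaxation hα hβ hμ x ht)
    (fun t ht => hasDerivAt_rlIntegral_relaxation hα hβ hμ x ht) ?_ ?_ one_pos
  · simpa [relaxation] using key
  · have h1 : Tendsto (fun s : ℝ => relaxationProfile α β μ (x * s ^ (α + β))) (𝓝[>] 0) (𝓝 1) := by
      have h2 : Tendsto (fun s : ℝ => x * s ^ (α + β)) (𝓝[>] 0) (𝓝 (x * 0)) :=
        (((tendsto_rpow_add_nhdsGT_zero hβ).mono_right nhdsWithin_le_nhds)).const_mul x
      have h3 := ((differentiable_relaxationProfile hα hβ hμ).continuous.tendsto (x * 0)).comp h2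
      rwa [mul_zero, relaxationProfile_zero] at h3
    filter_upwards [h1.eventually (lt_mem_nhds one_pos), self_mem_nhdsWithin] with s hs hs0
    exact mul_pos (Real.rpow_pos_of_pos hs0 _) hs
  -- At a zero the term with `λ` drops out and only the nonnegative source remains.
  · intro t ht h
    rw [h, mul_zero, sub_zero]
    exact mul_nonneg (Real.rpow_nonneg ht.le _) (Gamma_div_Gamma_nonneg hα.1 hμ)

theorem relaxation_pos (hα : α ∈ Ioo (0 : ℝ) 1) (hβ : -α < β) (hμ : -1 ≤ μ) {lam t : ℝ}
    (hl : 0 ≤ lam) (ht : 0 < t) : 0 < relaxation α β μ lam t :=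
  mul_pos (Real.rpow_pos_of_pos ht _) (relaxationProfile_pos hα hβ hμ (by positivity))

theorem relaxationProfile_lt (hα : α ∈ Ioo (0 : ℝ) 1) (hβ : -α < β) (hμ : -1 ≤ μ) {x y : ℝ}
    (hx : 0 ≤ x) (hxy : x < y) : relaxationProfile α β μ y < relaxationProfile α β μ x := by
  have key := pos_of_rlDeriv_nonneg_at_zeros
    (w := fun t => relaxation α β μ x t - relaxation α β μ y t) hα
    (fun t ht => (differentiableAt_relaxation hα hβ hμ x ht).sub
      (differentiableAt_relaxation hα hβ hμ y ht))
    (fun t ht => ((intervalIntegrable_rlIntegrand_relaxation hα hβ hμ x ht).sub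
      (intervalIntegrable_rlIntegrand_relaxation hα hβ hμ y ht)).congr fun s _ => by
        simp [rlIntegrand, mul_sub])
    (fun t ht => ((hasDerivAt_rlIntegral_relaxation hα hβ hμ x ht).sub
      (hasDerivAt_rlIntegral_relaxation hα hβ hμ y ht)).congr_of_eventuallyEq (by
        filter_upwards [Ioi_mem_nhds ht] with s hs
        exact rlIntegral_sub (intervalIntegrable_rlIntegrand_relaxation hα hβ hμ x hs)
          (intervalIntegrable_rlIntegrand_relaxation hα hβ hμ y hs))) ?_ ?_ one_pos
  · simpa [relaxation] using key
  -- Near `0` the leading terms cancel; the next one, `(y - x) c₁ r` with `r = s^(α+β)`, decides the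
  -- sign.
  · have hd : HasDerivAt (fun r => relaxationProfile α β μ (x * r) - relaxationProfile α β μ (y * r))
        ((y - x) * relaxationCoeff α β μ 1) 0 := by
      have h1 := hasDerivAt_relaxationProfile hα hβ hμ 0
      have e : -∑' n : ℕ, relaxationCoeff α β μ n * (n * (-(0 : ℝ)) ^ (n - 1))
          = -relaxationCoeff α β μ 1 := by
        rw [tsum_eq_single 1]
        · simp
        · intro n hn
          rcases n with _ | _ | n
          · simp
          · exact absurd rfl hn
          · simp
      rw [e] at h1
      have h2 (a : ℝ) : HasDerivAt (fun r => relaxationProfile α β μ (a * r))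
          (-relaxationCoeff α β μ 1 * a) 0 := by
        have h3 : HasDerivAt (relaxationProfile α β μ) (-relaxationCoeff α β μ 1) (a * 0) := by
          rwa [mul_zero]
        have h4 : HasDerivAt (fun r : ℝ => a * r) a 0 := by
          simpa using (hasDerivAt_id (0 : ℝ)).const_mul a
        exact h3.comp (0 : ℝ) h4
      refine ((h2 x).sub (h2 y)).congr_deriv ?_
      ring
    have hpos : 0 < (y - x) * relaxationCoeff α β μ 1 :=
      mul_pos (sub_pos.2 hxy) (relaxationCoeff_pos hα.1 hβ hμ 1)
    have h5 := (tendsto_rpow_add_nhdsGT_zero hβ).eventually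
      (hd.tendsto_slope_zero_right.eventually (lt_mem_nhds hpos))
    filter_upwards [h5, self_mem_nhdsWithin] with s hs hs0
    have hs1 : 0 < s ^ (α + β) := Real.rpow_pos_of_pos hs0 _
    simp only [zero_add, mul_zero, sub_self, sub_zero, smul_eq_mul] at hs
    have := pos_of_mul_pos_right hs (inv_nonneg.2 hs1.le)
    rw [relaxation, relaxation, ← mul_sub]
    exact mul_pos (Real.rpow_pos_of_pos hs0 _) this
  -- Where the two solutions meet, the sources cancel and `(y - x) t^β` times the common positive
  -- value is left.
  · intro t ht h
    rw [sub_eq_zero.1 h]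
    have h1 := relaxation_pos hα hβ hμ (hx.trans hxy.le) ht
    have h2 : 0 ≤ (y - x) * (t ^ β * relaxation α β μ y t) :=
      mul_nonneg (sub_nonneg.2 hxy.le) (mul_nonneg (Real.rpow_nonneg ht.le _) h1.le)
    linarith

theorem relaxationProfile_le_of_le (hα : α ∈ Ioo (0 : ℝ) 1) (hβ : -α < β) (hμ : -1 ≤ μ) {x y : ℝ}
    (hx : 0 ≤ x) (hxy : x ≤ y) : relaxationProfile α β μ y ≤ relaxationProfile α β μ x := by
  rcases eq_or_lt_of_le hxy with rfl | h
  · exact le_rfl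
  · exact (relaxationProfile_lt hα hβ hμ hx h).le

theorem relaxation_le (hα : α ∈ Ioo (0 : ℝ) 1) (hβ : -α < β) (hμ : -1 ≤ μ) {lam t : ℝ}
    (hl : 0 ≤ lam) (ht : 0 < t) : relaxation α β μ lam t ≤ t ^ (α + μ) := by
  have h := relaxationProfile_le_of_le hα hβ hμ le_rfl
    (by positivity : 0 ≤ lam * t ^ (α + β))
  rw [relaxationProfile_zero] at h
  exact mul_le_of_le_one_right (Real.rpow_nonneg ht.le _) h

theorem rlIntegral_relaxation_nonneg (hα : α ∈ Ioo (0 : ℝ) 1) (hβ : -α < β) (hμ : -1 ≤ μ)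
    {lam t : ℝ} (hl : 0 ≤ lam) (ht : 0 < t) :
    0 ≤ rlIntegral (α - 1) (relaxation α β μ lam) t := by
  have hz : rlIntegrand (α - 1) (fun _ : ℝ => (0 : ℝ)) t = fun _ => 0 := by
    funext s
    simp [rlIntegrand]
  have h := rlIntegral_mono (σ := α - 1) (g := fun _ => 0) (by linarith [hα.2]) ht
    (by rw [hz]; simp) (intervalIntegrable_rlIntegrand_relaxation hα hβ hμ lam ht)
    (fun s hs => (relaxation_pos hα hβ hμ hl hs.1).le)
  simpa [rlIntegral, hz] using h

theorem rlIntegral_relaxation_le (hα : α ∈ Ioo (0 : ℝ) 1) (hβ : -α < β) (hμ : -1 ≤ μ)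
    {lam t : ℝ} (hl : 0 ≤ lam) (ht : 0 < t) :
    rlIntegral (α - 1) (relaxation α β μ lam) t
      ≤ Real.Gamma (α + μ + 1) / Real.Gamma (μ + 2) * t ^ (μ + 1) := by
  have h1 := intervalIntegrable_rlIntegrand_rpow (σ := α - 1) (p := α + μ) (by linarith [hα.2])
    (by linarith [hα.1]) ht
  have h := rlIntegral_mono (σ := α - 1) (by linarith [hα.2]) ht
    (intervalIntegrable_rlIntegrand_relaxation hα hβ hμ lam ht) h1
    (fun s hs => relaxation_le hα hβ hμ hl hs.1)
  rw [rlIntegral_rpow (by linarith [hα.2]) (by linarith [hα.1]) ht,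
    show α + μ + 1 - (α - 1) = μ + 2 by ring, show α + μ - (α - 1) = μ + 1 by ring] at h
  exact h

/-- On `[1/2, 1]` the slope of `J^{α-1} y` is at least `-2B`, since its value at `1` is nonnegative
and its value at `1/2` is at most `B`. At a mean value point `ξ` the equation then bounds `x ξ^β
y(ξ)` by `2B + 2G`, and monotonicity replaces `E(-x ξ^(α+β))` by the smaller `E(-x)`. -/
theorem exists_mul_relaxationProfile_le (hα : α ∈ Ioo (0 : ℝ) 1) (hβ : -α < β) (hμ : -1 ≤ μ) :
    ∃ C, 0 ≤ C ∧ ∀ x, 0 ≤ x → x * relaxationProfile α β μ x ≤ C := by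
  set B := Real.Gamma (α + μ + 1) / Real.Gamma (μ + 2) with hB
  set G := Real.Gamma (α + μ + 1) / Real.Gamma (μ + 1) with hG
  -- A lower bound for `ξ^(α+β+μ)` on `[1/2, 1]`, whatever the sign of the exponent.
  set κ := (1 / 2 : ℝ) ^ |α + β + μ| with hκ
  have hκ0 : 0 < κ := by positivity
  have hB0 : 0 ≤ B := div_nonneg (Real.Gamma_nonneg_of_nonneg (by linarith [hα.1]))
    (Real.Gamma_nonneg_of_nonneg (by linarith))
  have hG0 : 0 ≤ G := Gamma_div_Gamma_nonneg hα.1 hμ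
  refine ⟨(2 * B + 2 * G) / κ, by positivity, fun x hx => ?_⟩
  have hder : ∀ s ∈ Icc (1 / 2 : ℝ) 1, HasDerivAt (rlIntegral (α - 1) (relaxation α β μ x))
      (s ^ μ * G - x * s ^ β * relaxation α β μ x s) s :=
    fun s hs => hasDerivAt_rlIntegral_relaxation hα hβ hμ x (by linarith [hs.1])
  obtain ⟨ξ, hξ, hξ'⟩ := exists_hasDerivAt_eq_slope (rlIntegral (α - 1) (relaxation α β μ x)) _
    (by norm_num : (1 / 2 : ℝ) < 1) (fun s hs => (hder s hs).continuousAt.continuousWithinAt)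
    (fun s hs => hder s ⟨hs.1.le, hs.2.le⟩)
  have hξ0 : 0 < ξ := by linarith [hξ.1]
  have hW1 := rlIntegral_relaxation_nonneg hα hβ hμ hx one_pos
  have hW2 := rlIntegral_relaxation_le hα hβ hμ hx (by norm_num : (0 : ℝ) < 1 / 2)
  have hpow : (1 / 2 : ℝ) ^ (μ + 1) ≤ 1 := Real.rpow_le_one (by norm_num) (by norm_num)
    (by linarith)
  have hW3 := hW2.trans (mul_le_of_le_one_right hB0 hpow)
  have hξμ : ξ ^ μ ≤ 2 := by
    calc ξ ^ μ ≤ ξ ^ (-1 : ℝ) := Real.rpow_le_rpow_of_exponent_ge hξ0 hξ.2.le hμ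
      _ = ξ⁻¹ := Real.rpow_neg_one ξ
      _ ≤ 2 := by
        rw [inv_le_comm₀ hξ0 two_pos]
        linarith [hξ.1]
  have hξκ : κ ≤ ξ ^ (α + β + μ) := by
    calc κ ≤ ξ ^ |α + β + μ| := Real.rpow_le_rpow (by norm_num) hξ.1.le (abs_nonneg _)
      _ ≤ _ := Real.rpow_le_rpow_of_exponent_ge hξ0 hξ.2.le (le_abs_self _)
  have hρ := relaxationProfile_pos hα hβ hμ hx
  have hρle : relaxationProfile α β μ x ≤ relaxationProfile α β μ (x * ξ ^ (α + β)) :=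
    relaxationProfile_le_of_le hα hβ hμ (by positivity)
      (mul_le_of_le_one_right hx (Real.rpow_le_one hξ0.le hξ.2.le (by linarith)))
  have hρ' := relaxationProfile_pos hα hβ hμ (by positivity : 0 ≤ x * ξ ^ (α + β))
  have hmain : x * relaxationProfile α β μ x * κ ≤ x * ξ ^ β * relaxation α β μ x ξ := by
    calc x * relaxationProfile α β μ x * κ
        ≤ x * relaxationProfile α β μ (x * ξ ^ (α + β)) * ξ ^ (α + β + μ) := by gcongr
      _ = x * ξ ^ β * relaxation α β μ x ξ := by
        rw [relaxation, show α + β + μ = β + (α + μ) by ring, Real.rpow_add hξ0 β]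
        ring
  rw [le_div_iff₀ hκ0]
  have h1 : ξ ^ μ * G ≤ 2 * G := by gcongr
  have h2 : ξ ^ μ * G - x * ξ ^ β * relaxation α β μ x ξ ≥ -(2 * B) := by
    rw [hξ', ge_iff_le, le_div_iff₀ (by norm_num)]
    linarith
  linarith

theorem exists_mul_relaxation_le (hα : α ∈ Ioo (0 : ℝ) 1) (hβ : -α < β) (hμ : -1 ≤ μ) :
    ∃ C, 0 ≤ C ∧ ∀ lam t, 0 ≤ lam → 0 < t → lam * relaxation α β μ lam t ≤ C * t ^ (μ - β) := by
  obtain ⟨C, hC0, hC⟩ := exists_mul_relaxationProfile_le hα hβ hμ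
  refine ⟨C, hC0, fun lam t hl ht => ?_⟩
  have h := hC (lam * t ^ (α + β)) (by positivity)
  have e : t ^ (α + μ) = t ^ (α + β) * t ^ (μ - β) := by
    rw [← Real.rpow_add ht]
    congr 1
    ring
  calc lam * relaxation α β μ lam t
      = lam * t ^ (α + β) * relaxationProfile α β μ (lam * t ^ (α + β)) * t ^ (μ - β) := by
        rw [relaxation, e]
        ring
    _ ≤ _ := by gcongr

end RelaxationBounds

/-! ### Diagonal operators in a Hilbert basis and the domain of `A`. -/

section Diagonal

variable {𝕜 H : Type*} [RCLike 𝕜] [NormedAddCommGroup H] [InnerProductSpace 𝕜 H]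

theorem HilbertBasis.hasSum_norm_inner_sq (v : HilbertBasis ℕ 𝕜 H) (z : H) :
    HasSum (fun k => ‖inner 𝕜 (v k) z‖ ^ 2) (‖z‖ ^ 2) := by
  have h := lp.hasSum_norm (p := 2) (by norm_num) (v.repr z)
  simpa [v.repr_apply_apply] using h

theorem HilbertBasis.ext_inner (v : HilbertBasis ℕ 𝕜 H) {a b : H}
    (h : ∀ k, inner 𝕜 (v k) a = inner 𝕜 (v k) b) : a = b := by
  refine v.repr.injective (lp.ext (funext fun k => ?_))
  rw [v.repr_apply_apply, v.repr_apply_apply, h k]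

/-- Parseval turns the squared distance into a series, to which dominated convergence applies. -/
theorem HilbertBasis.tendsto_of_dominated (v : HilbertBasis ℕ 𝕜 H) {ι : Type*} {l : Filter ι}
    {F : ι → H} {a : H} {g : ℕ → ℝ} (hg : Summable fun k => g k ^ 2)
    (hb : ∀ᶠ i in l, ∀ k, ‖inner 𝕜 (v k) (F i - a)‖ ≤ g k)
    (hF : ∀ k, Tendsto (fun i => inner 𝕜 (v k) (F i)) l (𝓝 (inner 𝕜 (v k) a))) :
    Tendsto F l (𝓝 a) := by
  have h1 : Tendsto (fun i => ∑' k, ‖inner 𝕜 (v k) (F i - a)‖ ^ 2) l (𝓝 (∑' _ : ℕ, (0 : ℝ))) := by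
    refine tendsto_tsum_of_dominated_convergence hg (fun k => ?_) ?_
    · have h2 : Tendsto (fun i => inner 𝕜 (v k) (F i - a)) l (𝓝 0) := by
        simp_rw [inner_sub_right]
        simpa using (hF k).sub_const (inner 𝕜 (v k) a)
      simpa using h2.norm.pow 2
    · filter_upwards [hb] with i hi k
      rw [norm_pow, norm_norm]
      exact pow_le_pow_left₀ (norm_nonneg _) (hi k) 2
  simp_rw [(v.hasSum_norm_inner_sq _).tsum_eq, tsum_zero] at h1
  rw [tendsto_iff_norm_sub_tendsto_zero]
  have h2 := (Real.continuous_sqrt.tendsto 0).comp h1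
  rw [Real.sqrt_zero] at h2
  exact h2.congr fun i => Real.sqrt_sq (norm_nonneg _)

/-- The diagonal operator with respect to a Hilbert basis with bounded real multipliers `m`. -/
def HilbertBasis.diagonal (v : HilbertBasis ℕ 𝕜 H) (m : ℕ → ℝ) (x : H) : H :=
  ∑' k, (m k • inner 𝕜 (v k) x) • v k

variable (v : HilbertBasis ℕ 𝕜 H) {m : ℕ → ℝ} {M : ℝ}

theorem HilbertBasis.hasSum_diagonal (hm : ∀ k, |m k| ≤ M) (x : H) :
    HasSum (fun k => (m k • inner 𝕜 (v k) x) • v k) (v.diagonal m x) := by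
  have hmem : Memℓp (fun k => m k • inner 𝕜 (v k) x) 2 := by
    refine memℓp_gen ?_
    have h := ((v.hasSum_norm_inner_sq x).summable).mul_left (M ^ 2)
    refine Summable.of_nonneg_of_le (fun k => by positivity) (fun k => ?_) h
    simp only [ENNReal.toReal_ofNat, Real.rpow_two]
    rw [norm_smul, mul_pow]
    gcongr
    exact hm k
  exact (v.hasSum_repr_symm ⟨_, hmem⟩).summable.hasSum

theorem HilbertBasis.inner_diagonal (hm : ∀ k, |m k| ≤ M) (x : H) (j : ℕ) :
    inner 𝕜 (v j) (v.diagonal m x) = m j • inner 𝕜 (v j) x := by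
  have h := (v.hasSum_diagonal hm x).mapL (innerSL 𝕜 (v j))
  have h2 := hasSum_single (f := fun k => innerSL 𝕜 (v j) ((m k • inner 𝕜 (v k) x) • v k)) j
    (fun k hk => by
      simp [innerSL_apply_apply, v.orthonormal.2 hk.symm])
  have h3 := h.unique h2
  simpa [innerSL_apply_apply, inner_smul_right, v.orthonormal.1 j, inner_self_eq_norm_sq_to_K]
    using h3

theorem HilbertBasis.norm_diagonal_le (hm : ∀ k, |m k| ≤ M) (x : H) :
    ‖v.diagonal m x‖ ≤ M * ‖x‖ := by
  have hM : 0 ≤ M := (abs_nonneg _).trans (hm 0)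
  refine le_of_sq_le_sq ?_ (by positivity)
  rw [mul_pow]
  refine hasSum_le (fun k => ?_) (v.hasSum_norm_inner_sq _)
    ((v.hasSum_norm_inner_sq x).mul_left (M ^ 2))
  rw [v.inner_diagonal hm, norm_smul, mul_pow]
  gcongr
  exact hm k

theorem HilbertBasis.tendsto_diagonal {ι : Type*} {l : Filter ι} {m : ι → ℕ → ℝ} {m₀ : ℕ → ℝ}
    (hm : ∀ᶠ i in l, ∀ k, |m i k| ≤ M) (hm₀ : ∀ k, |m₀ k| ≤ M)
    (hlim : ∀ k, Tendsto (fun i => m i k) l (𝓝 (m₀ k))) (x : H) :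
    Tendsto (fun i => v.diagonal (m i) x) l (𝓝 (v.diagonal m₀ x)) := by
  refine v.tendsto_of_dominated (g := fun k => 2 * M * ‖inner 𝕜 (v k) x‖) ?_ ?_ fun k => ?_
  · simp_rw [mul_pow]
    exact (v.hasSum_norm_inner_sq x).summable.mul_left _
  · filter_upwards [hm] with i hi k
    rw [inner_sub_right, v.inner_diagonal hi, v.inner_diagonal hm₀, ← sub_smul, norm_smul]
    gcongr
    rw [Real.norm_eq_abs]
    linarith [abs_sub (m i k) (m₀ k), hi k, hm₀ k]
  · rw [v.inner_diagonal hm₀]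
    refine ((hlim k).smul_const _).congr' ?_
    filter_upwards [hm] with i hi
    rw [v.inner_diagonal hi]

theorem inner_real_smul_right [NormedSpace ℝ H] [IsScalarTower ℝ 𝕜 H] (a b : H) (r : ℝ) :
    inner 𝕜 a (r • b) = r • inner 𝕜 a b := by
  rw [RCLike.real_smul_eq_coe_smul (K := 𝕜), inner_smul_right, RCLike.real_smul_eq_coe_mul]

theorem HilbertBasis.diagonal_const [NormedSpace ℝ H] [IsScalarTower ℝ 𝕜 H] (c : ℝ) (x : H) :
    v.diagonal (fun _ => c) x = c • x :=
  v.ext_inner fun k => by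
    rw [v.inner_diagonal (fun _ => le_rfl), inner_real_smul_right]

variable [CompleteSpace H]

theorem inner_apply_eigenvector {A : H →ₗ.[𝕜] H} (hA : IsSelfAdjoint A) {w : H} {r : ℝ}
    [NormedSpace ℝ H] [IsScalarTower ℝ 𝕜 H]
    (hw : ∃ h : w ∈ A.domain, A ⟨w, h⟩ = r • w) (x : A.domain) :
    inner 𝕜 w (A x) = r • inner 𝕜 w (x : H) := by
  obtain ⟨h, hAw⟩ := hw
  have hf := LinearPMap.adjoint_isFormalAdjoint (T := A) hA.dense_domain
  rw [LinearPMap.isSelfAdjoint_def.1 hA] at hf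
  have h1 := hf ⟨w, h⟩ x
  rw [hAw] at h1
  simp only at h1
  rw [← h1, RCLike.real_smul_eq_coe_smul (K := 𝕜), inner_smul_left, RCLike.conj_ofReal,
    RCLike.real_smul_eq_coe_mul]

/-- By Parseval `(g, x) = (y, A x)` for every `x` in the domain, so `y` lies in the domain of `A*`,
which is that of `A`. -/
theorem exists_mem_domain_of_inner_eq {A : H →ₗ.[𝕜] H} (hA : IsSelfAdjoint A)
    [NormedSpace ℝ H] [IsScalarTower ℝ 𝕜 H] {lam : ℕ → ℝ}
    (hv : ∀ k, ∃ h : v k ∈ A.domain, A ⟨v k, h⟩ = lam k • v k) {y g : H}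
    (h : ∀ k, inner 𝕜 (v k) g = lam k • inner 𝕜 (v k) y) :
    ∃ hy : y ∈ A.domain, A ⟨y, hy⟩ = g := by
  have key : ∀ x : A.domain, inner 𝕜 g (x : H) = inner 𝕜 y (A x) := fun x => by
    rw [← v.tsum_inner_mul_inner, ← v.tsum_inner_mul_inner]
    refine tsum_congr fun k => ?_
    rw [inner_apply_eigenvector hA (hv k), ← inner_conj_symm g, h k, ← inner_conj_symm y,
      RCLike.real_smul_eq_coe_mul, RCLike.real_smul_eq_coe_mul, map_mul, RCLike.conj_ofReal]
    ring
  have h2 : ∃ hy : y ∈ A.adjoint.domain, A.adjoint ⟨y, hy⟩ = g :=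
    ⟨LinearPMap.mem_adjoint_domain_of_exists y ⟨g, key⟩,
      LinearPMap.adjoint_apply_eq hA.dense_domain _ key⟩
  rwa [LinearPMap.isSelfAdjoint_def.1 hA] at h2

end Diagonal

/-! ### The vector-valued series and its fractional derivative. -/

section VectorRelaxation

theorem rlIntegral_congr {H : Type*} [NormedAddCommGroup H] [NormedSpace ℝ H] {g h : ℝ → H}
    {σ t : ℝ} (ht : 0 < t) (hgh : ∀ s, 0 < s → g s = h s) :
    rlIntegral σ g t = rlIntegral σ h t := by
  rw [rlIntegral, rlIntegral, intervalIntegral.integral_of_le ht.le,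
    intervalIntegral.integral_of_le ht.le]
  congr 1
  refine setIntegral_congr_fun measurableSet_Ioc fun s hs => ?_
  simp only [rlIntegrand]
  rw [hgh s hs.1]

theorem abs_relaxation_le {lam : ℕ → ℝ} {α β μ t : ℝ} (hlam : ∀ k, 0 < lam k)
    (hα : α ∈ Ioo (0 : ℝ) 1) (hβ : -α < β) (hμ : -1 ≤ μ) (ht : 0 < t) (k : ℕ) :
    |relaxation α β μ (lam k) t| ≤ t ^ (α + μ) := by
  rw [abs_of_pos (relaxation_pos hα hβ hμ (hlam k).le ht)]
  exact relaxation_le hα hβ hμ (hlam k).le ht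

theorem exists_abs_mul_relaxation_le {lam : ℕ → ℝ} {α β μ : ℝ} (hlam : ∀ k, 0 < lam k)
    (hα : α ∈ Ioo (0 : ℝ) 1) (hβ : -α < β) (hμ : -1 ≤ μ) :
    ∃ C, ∀ t, 0 < t → ∀ k, |lam k * relaxation α β μ (lam k) t| ≤ C * t ^ (μ - β) := by
  obtain ⟨C, _, hC⟩ := exists_mul_relaxation_le hα hβ hμ
  refine ⟨C, fun t ht k => ?_⟩
  rw [abs_of_pos (mul_pos (hlam k) (relaxation_pos hα hβ hμ (hlam k).le ht))]
  exact hC _ _ (hlam k).le ht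

variable {𝕜 H : Type*} [RCLike 𝕜] [NormedAddCommGroup H] [InnerProductSpace 𝕜 H]

/-- The vector-valued relaxation function `∑ y_k(t) (v_k, x) v_k`. -/
def vectorRelaxation (v : HilbertBasis ℕ 𝕜 H) (lam : ℕ → ℝ) (α β μ : ℝ) (x : H) (t : ℝ) : H :=
  v.diagonal (fun k => relaxation α β μ (lam k) t) x

/-- The series `∑ lam_k y_k(t) (v_k, x) v_k`. -/
def vectorRelaxationImage (v : HilbertBasis ℕ 𝕜 H) (lam : ℕ → ℝ) (α β μ : ℝ) (x : H) (t : ℝ) : H :=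
  v.diagonal (fun k => lam k * relaxation α β μ (lam k) t) x

theorem HilbertBasis.continuousOn_diagonal (v : HilbertBasis ℕ 𝕜 H) {m : ℝ → ℕ → ℝ} {C p : ℝ}
    (hm : ∀ t, 0 < t → ∀ k, |m t k| ≤ C * t ^ p)
    (hc : ∀ k, ContinuousOn (fun t => m t k) (Ioi 0)) (x : H) :
    ContinuousOn (fun t => v.diagonal (m t) x) (Ioi 0) := by
  intro t ht
  have ht0 : 0 < t := ht
  refine ContinuousAt.continuousWithinAt ?_
  have h1 : Tendsto (fun s : ℝ => C * s ^ p) (𝓝 t) (𝓝 (C * t ^ p)) :=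
    ((Real.continuousAt_rpow_const t p (Or.inl ht0.ne')).tendsto).const_mul C
  -- The bound `C s^p` may blow up at `0`; near `t` it stays below its value at `t` plus one.
  refine v.tendsto_diagonal (M := C * t ^ p + 1) ?_ (fun k => (hm t ht k).trans (by linarith))
    (fun k => ((hc k).continuousAt (Ioi_mem_nhds ht0)).tendsto) x
  filter_upwards [h1.eventually (gt_mem_nhds (lt_add_one _)), Ioi_mem_nhds ht0] with s hs hs0 k
  exact (hm s hs0 k).trans hs.le

variable (v : HilbertBasis ℕ 𝕜 H) {lam : ℕ → ℝ} {α β μ : ℝ}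

theorem inner_vectorRelaxation (hlam : ∀ k, 0 < lam k)
    (hα : α ∈ Ioo (0 : ℝ) 1) (hβ : -α < β) (hμ : -1 ≤ μ) (x : H) {t : ℝ} (ht : 0 < t) (k : ℕ) :
    inner 𝕜 (v k) (vectorRelaxation v lam α β μ x t)
      = relaxation α β μ (lam k) t • inner 𝕜 (v k) x :=
  v.inner_diagonal (abs_relaxation_le hlam hα hβ hμ ht) x k

theorem inner_vectorRelaxationImage (hlam : ∀ k, 0 < lam k)
    (hα : α ∈ Ioo (0 : ℝ) 1) (hβ : -α < β) (hμ : -1 ≤ μ) (x : H) {t : ℝ} (ht : 0 < t) (k : ℕ) :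
    inner 𝕜 (v k) (vectorRelaxationImage v lam α β μ x t)
      = (lam k * relaxation α β μ (lam k) t) • inner 𝕜 (v k) x := by
  obtain ⟨C, hC⟩ := exists_abs_mul_relaxation_le hlam hα hβ hμ
  exact v.inner_diagonal (hC t ht) x k

theorem continuousOn_vectorRelaxation (hlam : ∀ k, 0 < lam k)
    (hα : α ∈ Ioo (0 : ℝ) 1) (hβ : -α < β) (hμ : -1 ≤ μ) (x : H) :
    ContinuousOn (vectorRelaxation v lam α β μ x) (Ioi 0) :=
  v.continuousOn_diagonal (C := 1) (p := α + μ)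
    (fun _ ht k => (abs_relaxation_le hlam hα hβ hμ ht k).trans_eq (one_mul _).symm)
    (fun k => continuousOn_relaxation hα hβ hμ (lam k)) x

theorem continuousOn_vectorRelaxationImage (hlam : ∀ k, 0 < lam k)
    (hα : α ∈ Ioo (0 : ℝ) 1) (hβ : -α < β) (hμ : -1 ≤ μ) (x : H) :
    ContinuousOn (vectorRelaxationImage v lam α β μ x) (Ioi 0) := by
  obtain ⟨C, hC⟩ := exists_abs_mul_relaxation_le hlam hα hβ hμ
  exact v.continuousOn_diagonal hC
    (fun k => continuousOn_const.mul (continuousOn_relaxation hα hβ hμ (lam k))) x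

variable [NormedSpace ℝ H]

theorem intervalIntegrable_rlIntegrand_vectorRelaxation (hlam : ∀ k, 0 < lam k)
    (hα : α ∈ Ioo (0 : ℝ) 1) (hβ : -α < β) (hμ : -1 ≤ μ) (x : H) {t : ℝ} (ht : 0 < t) :
    IntervalIntegrable (rlIntegrand (α - 1) (vectorRelaxation v lam α β μ x) t) volume 0 t := by
  have h := (intervalIntegrable_rlIntegrand_rpow (σ := α - 1) (p := α + μ) (by linarith [hα.2])
    (by linarith [hα.1]) ht).const_mul ‖x‖
  refine intervalIntegrable_rlIntegrand_of_norm_le (g := fun s => ‖x‖ • s ^ (α + μ))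
    (continuousOn_vectorRelaxation v hlam hα hβ hμ x) ht
    (by rw [rlIntegrand_const_smul]; exact h) fun s hs => ?_
  rw [smul_eq_mul, mul_comm]
  exact v.norm_diagonal_le (abs_relaxation_le hlam hα hβ hμ hs) x

variable [IsScalarTower ℝ 𝕜 H]

/-- The real-linear coordinate functional `x ↦ (v_k, x)`. -/
def HilbertBasis.coord (k : ℕ) : H →L[ℝ] 𝕜 :=
  (innerSL 𝕜 (v k)).restrictScalars ℝ

theorem HilbertBasis.coord_apply (k : ℕ) (x : H) : v.coord k x = inner 𝕜 (v k) x := rfl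

variable [CompleteSpace H]

theorem inner_rlIntegral_vectorRelaxation (hlam : ∀ k, 0 < lam k)
    (hα : α ∈ Ioo (0 : ℝ) 1) (hβ : -α < β) (hμ : -1 ≤ μ) (x : H) {t : ℝ} (ht : 0 < t) (k : ℕ) :
    inner 𝕜 (v k) (rlIntegral (α - 1) (vectorRelaxation v lam α β μ x) t)
      = rlIntegral (α - 1) (relaxation α β μ (lam k)) t • inner 𝕜 (v k) x := by
  rw [← v.coord_apply, ← rlIntegral_clm _
    (intervalIntegrable_rlIntegrand_vectorRelaxation v hlam hα hβ hμ x ht)]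
  have h := rlIntegral_clm ((ContinuousLinearMap.id ℝ ℝ).smulRight (inner 𝕜 (v k) x))
    (intervalIntegrable_rlIntegrand_relaxation hα hβ hμ (lam k) ht)
  simp only [ContinuousLinearMap.smulRight_apply, ContinuousLinearMap.id_apply] at h
  rw [← h]
  exact rlIntegral_congr ht fun s hs => inner_vectorRelaxation v hlam hα hβ hμ x hs k

theorem rlIntegral_vectorRelaxation_eq_diagonal (hlam : ∀ k, 0 < lam k)
    (hα : α ∈ Ioo (0 : ℝ) 1) (hβ : -α < β) (hμ : -1 ≤ μ) (x : H) {t : ℝ} (ht : 0 < t) :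
    rlIntegral (α - 1) (vectorRelaxation v lam α β μ x) t
      = v.diagonal (fun k => rlIntegral (α - 1) (relaxation α β μ (lam k)) t) x := by
  refine v.ext_inner fun k => ?_
  rw [inner_rlIntegral_vectorRelaxation v hlam hα hβ hμ x ht, v.inner_diagonal
    (M := Real.Gamma (α + μ + 1) / Real.Gamma (μ + 2) * t ^ (μ + 1)) fun j => ?_]
  rw [abs_of_nonneg (rlIntegral_relaxation_nonneg hα hβ hμ (hlam j).le ht)]
  exact rlIntegral_relaxation_le hα hβ hμ (hlam j).le ht

theorem tendsto_rlIntegral_vectorRelaxation (hlam : ∀ k, 0 < lam k)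
    (hα : α ∈ Ioo (0 : ℝ) 1) (hβ : -α < β) (hμ : -1 ≤ μ) (x : H) :
    Tendsto (rlIntegral (α - 1) (vectorRelaxation v lam α β μ x)) (𝓝[>] 0)
      (𝓝 (((0 : ℝ) ^ (μ + 1) * (Real.Gamma (α + μ + 1) / Real.Gamma (μ + 2))) • x)) := by
  set B := Real.Gamma (α + μ + 1) / Real.Gamma (μ + 2) with hB
  have hB0 : 0 ≤ B := div_nonneg (Real.Gamma_nonneg_of_nonneg (by linarith [hα.1]))
    (Real.Gamma_nonneg_of_nonneg (by linarith))
  have h0 : (0 : ℝ) ≤ 0 ^ (μ + 1) := Real.rpow_nonneg le_rfl _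
  have h01 : (0 : ℝ) ^ (μ + 1) ≤ 1 := Real.rpow_le_one le_rfl zero_le_one (by linarith)
  rw [← v.diagonal_const]
  refine (v.tendsto_diagonal (M := B)
    (m := fun t k => rlIntegral (α - 1) (relaxation α β μ (lam k)) t) ?_ (fun k => ?_)
    (fun k => tendsto_rlIntegral_relaxation hα hβ hμ (lam k)) x).congr' ?_
  · filter_upwards [Ioo_mem_nhdsGT one_pos] with t ht k
    rw [abs_of_nonneg (rlIntegral_relaxation_nonneg hα hβ hμ (hlam k).le ht.1)]
    exact (rlIntegral_relaxation_le hα hβ hμ (hlam k).le ht.1).trans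
      (mul_le_of_le_one_right hB0 (Real.rpow_le_one ht.1.le ht.2.le (by linarith)))
  · rw [abs_of_nonneg (mul_nonneg h0 hB0)]
    exact mul_le_of_le_one_left hB0 h01
  · filter_upwards [self_mem_nhdsWithin] with t ht
    exact (rlIntegral_vectorRelaxation_eq_diagonal v hlam hα hβ hμ x ht).symm

/-- The expected derivative `R` is continuous on `(0, ∞)`. The fundamental theorem of calculus in
each coordinate shows that `J^{α-1}` is a primitive of `R`, and differentiating this Bochner
integral gives the claim. The base point is `t`, not `0`, because `R` need not be integrable at `0`.
-/
theorem hasDerivAt_rlIntegral_vectorRelaxation (hlam : ∀ k, 0 < lam k)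
    (hα : α ∈ Ioo (0 : ℝ) 1) (hβ : -α < β) (hμ : -1 ≤ μ) (x : H) {t : ℝ} (ht : 0 < t) :
    HasDerivAt (rlIntegral (α - 1) (vectorRelaxation v lam α β μ x))
      ((t ^ μ * (Real.Gamma (α + μ + 1) / Real.Gamma (μ + 1))) • x
        - t ^ β • vectorRelaxationImage v lam α β μ x t) t := by
  set R : ℝ → H := fun s => (s ^ μ * (Real.Gamma (α + μ + 1) / Real.Gamma (μ + 1))) • x
    - s ^ β • vectorRelaxationImage v lam α β μ x s with hR
  have hpow (p : ℝ) : ContinuousOn (fun s : ℝ => s ^ p) (Ioi 0) :=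
    continuousOn_id.rpow_const fun s hs => Or.inl (ne_of_gt hs)
  have hRc : ContinuousOn R (Ioi 0) :=
    (((hpow μ).mul continuousOn_const).smul continuousOn_const).sub
      ((hpow β).smul (continuousOn_vectorRelaxationImage v hlam hα hβ hμ x))
  have hsub {s : ℝ} (hs : 0 < s) : uIcc t s ⊆ Ioi 0 := fun r hr => (lt_min ht hs).trans_le hr.1
  have hRi {s : ℝ} (hs : 0 < s) : IntervalIntegrable R volume t s :=
    (hRc.mono (hsub hs)).intervalIntegrable
  have hrep {s : ℝ} (hs : 0 < s) : rlIntegral (α - 1) (vectorRelaxation v lam α β μ x) s =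
      rlIntegral (α - 1) (vectorRelaxation v lam α β μ x) t + ∫ r in t..s, R r := by
    refine v.ext_inner fun k => ?_
    rw [inner_add_right, inner_rlIntegral_vectorRelaxation v hlam hα hβ hμ x hs,
      inner_rlIntegral_vectorRelaxation v hlam hα hβ hμ x ht, ← sub_eq_iff_eq_add', ← sub_smul,
      ← v.coord_apply k (∫ r in t..s, R r), ← (v.coord k).intervalIntegral_comp_comm (hRi hs)]
    have hder : ∀ r ∈ uIcc t s, HasDerivAt (fun r =>
        rlIntegral (α - 1) (relaxation α β μ (lam k)) r • (inner 𝕜 (v k) x : 𝕜))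
        (v.coord k (R r)) r := fun r hr => by
      have hr0 : 0 < r := hsub hs hr
      refine ((hasDerivAt_rlIntegral_relaxation hα hβ hμ (lam k) hr0).smul_const
        (inner 𝕜 (v k) x : 𝕜)).congr_deriv ?_
      rw [v.coord_apply, inner_sub_right, inner_real_smul_right, inner_real_smul_right,
        inner_vectorRelaxationImage v hlam hα hβ hμ x hr0, smul_smul, ← sub_smul]
      congr 1
      ring
    rw [intervalIntegral.integral_eq_sub_of_hasDerivAt hder
      (((v.coord k).continuous.comp_continuousOn (hRc.mono (hsub hs))).intervalIntegrable),
      sub_smul]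
  have hF : HasDerivAt (fun s => rlIntegral (α - 1) (vectorRelaxation v lam α β μ x) t
      + ∫ r in t..s, R r) (R t) t :=
    (intervalIntegral.integral_hasDerivAt_right (hRi ht)
      (hRc.stronglyMeasurableAtFilter isOpen_Ioi t ht)
      (hRc.continuousAt (Ioi_mem_nhds ht))).const_add _
  refine hF.congr_of_eventuallyEq ?_
  filter_upwards [Ioi_mem_nhds ht] with s hs
  exact hrep hs

end VectorRelaxation

/-! ### Uniqueness for the vector problem. -/

section ForwardProblem

variable {𝕜 H : Type*} [RCLike 𝕜] [NormedAddCommGroup H] [InnerProductSpace 𝕜 H]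
  [CompleteSpace H] [NormedSpace ℝ H] [IsScalarTower ℝ 𝕜 H]

theorem IsForwardSolution.eqOn {A : H →ₗ.[𝕜] H} (hA : IsSelfAdjoint A)
    (v : HilbertBasis ℕ 𝕜 H) {lam : ℕ → ℝ} (hlam : ∀ k, 0 < lam k)
    (hv : ∀ k, ∃ h : v k ∈ A.domain, A ⟨v k, h⟩ = lam k • v k)
    {α β μ T : ℝ} (hα : α ∈ Ioo (0 : ℝ) 1) {φ f : H} {u w : ℝ → H}
    (hu : IsForwardSolution A α β μ T φ f u) (hw : IsForwardSolution A α β μ T φ f w) :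
    ∀ t ∈ Ioc 0 T, w t = u t := by
  -- The scalar argument needs real values; `L` will be the real and the imaginary part.
  have key : ∀ (k : ℕ) (L : 𝕜 →L[ℝ] ℝ), ∀ t ∈ Ioc 0 T, L (v.coord k (w t - u t)) = 0 := by
    intro k L
    set P : H →L[ℝ] ℝ := L.comp (v.coord k) with hP
    have hPA : ∀ y : A.domain, P (A y) = lam k * P y := fun y => by
      simp only [P, ContinuousLinearMap.comp_apply, v.coord_apply]
      rw [inner_apply_eigenvector hA (hv k), map_smul, smul_eq_mul]
    have hi : ∀ t, 0 < t →
        IntervalIntegrable (rlIntegrand (α - 1) (fun s => w s - u s) t) volume 0 t :=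
      fun t ht => ((hw.integrable t ht).sub (hu.integrable t ht)).congr fun s _ => by
        simp [rlIntegrand, smul_sub]
    have hJ : ∀ t, 0 < t → rlIntegral (α - 1) (fun s => P (w s - u s)) t
        = P (rlIntegral (α - 1) w t - rlIntegral (α - 1) u t) := fun t ht => by
      rw [rlIntegral_clm P (hi t ht), rlIntegral_sub (hw.integrable t ht) (hu.integrable t ht)]
    have hd : ∀ t, 0 < t → HasDerivAt (rlIntegral (α - 1) fun s => P (w s - u s))
        (P (rlDeriv α w t - rlDeriv α u t)) t := fun t ht => by
      refine (P.hasFDerivAt.comp_hasDerivAt t ((hw.differentiable t ht).hasDerivAt.sub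
        (hu.differentiable t ht).hasDerivAt)).congr_of_eventuallyEq ?_
      filter_upwards [Ioi_mem_nhds ht] with s hs
      exact hJ s hs
    refine eq_zero_of_rlDeriv_eq (z := fun s => P (w s - u s)) (q := fun t => t ^ β * lam k) hα
      (P.continuous.comp_continuousOn (hw.continuousOn.sub hu.continuousOn))
      (fun t ht => intervalIntegrable_rlIntegrand_clm P (hi t ht)) ?_
      (fun t ht => (hd t ht).continuousAt.continuousWithinAt)
      (fun t ht => mul_pos (Real.rpow_pos_of_pos ht.1 _) (hlam k)) fun t ht => ?_
    · have h1 := (P.continuous.tendsto _).comp (hw.initial.sub hu.initial)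
      rw [sub_self, map_zero] at h1
      refine h1.congr' ?_
      filter_upwards [self_mem_nhdsWithin] with t ht
      exact (hJ t ht).symm
    · refine (hd t ht.1).congr_deriv ?_
      rw [eq_sub_of_add_eq (hw.equation t ht), eq_sub_of_add_eq (hu.equation t ht),
        sub_sub_sub_cancel_left, map_sub, map_smul, map_smul, hPA, hPA, map_sub, smul_eq_mul,
        smul_eq_mul]
      ring
  intro t ht
  refine v.ext_inner fun k => ?_
  rw [← sub_eq_zero, ← inner_sub_right, ← v.coord_apply]
  exact RCLike.ext (by simpa using key k RCLike.reCLM t ht)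
    (by simpa using key k RCLike.imCLM t ht)

end ForwardProblem

end

/-! ### Superposition of the two series. -/

theorem theorem1 {𝕜 H : Type*} [RCLike 𝕜] [NormedAddCommGroup H] [InnerProductSpace 𝕜 H]
    [CompleteSpace H] [NormedSpace ℝ H] [IsScalarTower ℝ 𝕜 H]
    (A : H →ₗ.[𝕜] H) (hA : IsSelfAdjoint A)
    (hApos : ∀ x : A.domain, 0 ≤ RCLike.re (inner 𝕜 (A x) (x : H)))
    (v : HilbertBasis ℕ 𝕜 H) (lam : ℕ → ℝ)
    (hlam_pos : ∀ k, 0 < lam k) (hlam_mono : Monotone lam) (hlam_top : Tendsto lam atTop atTop)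
    (hv : ∀ k, ∃ h : v k ∈ A.domain, A ⟨v k, h⟩ = lam k • v k)
    (α β μ T : ℝ) (hα : α ∈ Ioo (0 : ℝ) 1) (hβ : -α < β) (hμ : -1 < μ) (hT : 0 < T)
    (φ f : H) :
    ∃ u : ℝ → H,
      IsForwardSolution A α β μ T φ f u ∧
      (∀ w : ℝ → H, IsForwardSolution A α β μ T φ f w → ∀ t ∈ Ioc 0 T, w t = u t) ∧
      ∀ t : ℝ, 0 < t →
        HasSum
          (fun k : ℕ =>
            ((t ^ (α - 1) / Real.Gamma α
                * kilbasSaigo α (1 + β / α) (1 + (β - 1) / α) (-(lam k) * t ^ (α + β)))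
                • inner 𝕜 (v k) φ
              + (Real.Gamma (μ + 1) * t ^ (α + μ) / Real.Gamma (μ + α + 1)
                * kilbasSaigo α (1 + β / α) (1 + (β + μ) / α) (-(lam k) * t ^ (α + β)))
                • inner 𝕜 (v k) f) • v k)
          (u t) := by
  have hG := Real.Gamma_pos_of_pos hα.1
  have hGμ := Real.Gamma_pos_of_pos (by linarith : 0 < μ + 1)
  have hGα := Real.Gamma_pos_of_pos (by linarith [hα.1] : 0 < μ + α + 1)
  set a := 1 / Real.Gamma α with ha
  set b := Real.Gamma (μ + 1) / Real.Gamma (μ + α + 1) with hb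
  set U₁ := vectorRelaxation v lam α β (-1) φ with hU₁
  set U₂ := vectorRelaxation v lam α β μ f with hU₂
  set G₁ := vectorRelaxationImage v lam α β (-1) φ with hG₁
  set G₂ := vectorRelaxationImage v lam α β μ f with hG₂
  have hμ' := hμ.le
  have hm : (-1 : ℝ) ≤ -1 := le_rfl
  have i₁ {t : ℝ} (ht : 0 < t) :=
    intervalIntegrable_rlIntegrand_vectorRelaxation v hlam_pos hα hβ hm φ ht
  have i₂ {t : ℝ} (ht : 0 < t) :=
    intervalIntegrable_rlIntegrand_vectorRelaxation v hlam_pos hα hβ hμ' f ht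
  have j₁ {t : ℝ} (ht : 0 < t) :
      IntervalIntegrable (rlIntegrand (α - 1) (fun s => a • U₁ s) t) volume 0 t := by
    rw [rlIntegrand_const_smul]
    exact (i₁ ht).smul a
  have j₂ {t : ℝ} (ht : 0 < t) :
      IntervalIntegrable (rlIntegrand (α - 1) (fun s => b • U₂ s) t) volume 0 t := by
    rw [rlIntegrand_const_smul]
    exact (i₂ ht).smul b
  set u : ℝ → H := fun t => a • U₁ t + b • U₂ t with hu
  set g : ℝ → H := fun t => a • G₁ t + b • G₂ t with hg
  have hJ {t : ℝ} (ht : 0 < t) : rlIntegral (α - 1) u t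
      = a • rlIntegral (α - 1) U₁ t + b • rlIntegral (α - 1) U₂ t := by
    rw [hu, rlIntegral_add (j₁ ht) (j₂ ht), rlIntegral_const_smul, rlIntegral_const_smul]
  have hd {t : ℝ} (ht : 0 < t) :
      HasDerivAt (rlIntegral (α - 1) u) (t ^ μ • f - t ^ β • g t) t := by
    have h₁ := hasDerivAt_rlIntegral_vectorRelaxation v hlam_pos hα hβ hm φ ht
    have h₂ := hasDerivAt_rlIntegral_vectorRelaxation v hlam_pos hα hβ hμ' f ht
    refine (((h₁.const_smul a).add (h₂.const_smul b)).congr_of_eventuallyEq ?_).congr_deriv ?_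
    · filter_upwards [Ioi_mem_nhds ht] with s hs
      exact hJ hs
    -- `Real.Gamma 0 = 0` and division by zero gives `0`, the true value of `1/Γ` at the pole: the
    -- part with `μ = -1` has no source.
    have e₁ : Real.Gamma (α + -1 + 1) / Real.Gamma (-1 + 1) = 0 := by simp
    have e₂ : b * (t ^ μ * (Real.Gamma (α + μ + 1) / Real.Gamma (μ + 1))) = t ^ μ := by
      rw [hb, add_comm α μ]
      field_simp
    rw [e₁, mul_zero, zero_smul, zero_sub, smul_sub b, smul_smul b, e₂, hg]
    simp only [smul_add, smul_neg]
    rw [smul_comm (t ^ β) a, smul_comm (t ^ β) b]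
    abel
  have hlim : Tendsto (rlIntegral (α - 1) u) (𝓝[>] 0) (𝓝 φ) := by
    have h₁ := tendsto_rlIntegral_vectorRelaxation v hlam_pos hα hβ hm φ
    have h₂ := tendsto_rlIntegral_vectorRelaxation v hlam_pos hα hβ hμ' f
    have h := (h₁.const_smul a).add (h₂.const_smul b)
    -- Since `0 ^ 0 = 1`, the first part carries the initial value, normalised by `a = 1 / Γ(α)`;
    -- the second tends to `0` because `μ + 1 > 0`.
    have e₁ : a * ((0 : ℝ) ^ ((-1 : ℝ) + 1) * (Real.Gamma (α + -1 + 1) / Real.Gamma (-1 + 2)))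
        = 1 := by
      rw [show (-1 : ℝ) + 1 = 0 by norm_num, show (-1 : ℝ) + 2 = 1 by norm_num,
        neg_add_cancel_right, Real.rpow_zero, Real.Gamma_one, ha]
      field_simp
    rw [Real.zero_rpow (by linarith : μ + 1 ≠ 0), zero_mul, zero_smul, smul_zero, add_zero,
      smul_smul, e₁, one_smul] at h
    refine h.congr' ?_
    filter_upwards [self_mem_nhdsWithin] with t ht
    exact (hJ ht).symm
  have hmem {t : ℝ} (ht : 0 < t) : ∃ hy : u t ∈ A.domain, A ⟨u t, hy⟩ = g t := by
    refine exists_mem_domain_of_inner_eq v hA hv fun k => ?_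
    rw [hg, hu]
    simp only [inner_add_right]
    rw [inner_real_smul_right, inner_real_smul_right, inner_real_smul_right, inner_real_smul_right,
      inner_vectorRelaxation v hlam_pos hα hβ hm φ ht,
      inner_vectorRelaxation v hlam_pos hα hβ hμ' f ht,
      inner_vectorRelaxationImage v hlam_pos hα hβ hm φ ht,
      inner_vectorRelaxationImage v hlam_pos hα hβ hμ' f ht]
    simp only [smul_add, smul_smul]
    congr 2 <;> ring
  have hgc : ContinuousOn g (Ioi 0) :=
    ((continuousOn_vectorRelaxationImage v hlam_pos hα hβ hm φ).const_smul a).add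
      ((continuousOn_vectorRelaxationImage v hlam_pos hα hβ hμ' f).const_smul b)
  have hpow (p : ℝ) : ContinuousOn (fun s : ℝ => s ^ p) (Ioi 0) :=
    continuousOn_id.rpow_const fun s hs => Or.inl (ne_of_gt hs)
  have hsol : IsForwardSolution A α β μ T φ f u :=
    { continuousOn := ((continuousOn_vectorRelaxation v hlam_pos hα hβ hm φ).const_smul a).add
        ((continuousOn_vectorRelaxation v hlam_pos hα hβ hμ' f).const_smul b)
      integrable := fun t ht => ((j₁ ht).add (j₂ ht)).congr fun s _ => by
        simp [rlIntegrand, hu]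
      continuousOn_integral := by
        -- At `0` the formula for the integral returns `0`, so the value `φ` is put in by hand.
        refine ⟨Function.update (rlIntegral (α - 1) u) 0 φ, fun t ht => ?_,
          fun t ht => Function.update_of_ne ht.ne' _ _⟩
        rcases eq_or_lt_of_le (show 0 ≤ t from ht) with rfl | h
        · rw [continuousWithinAt_update_same, Ici_sdiff_left]
          exact hlim
        · refine ((hd h).continuousAt.congr ?_).continuousWithinAt
          filter_upwards [Ioi_mem_nhds h] with s hs
          exact (Function.update_of_ne (ne_of_gt hs) _ _).symm
      differentiable := fun t ht => (hd ht).differentiableAt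
      continuousOn_deriv := by
        have hc : ContinuousOn (fun t => t ^ μ • f - t ^ β • g t) (Ioi 0) :=
          ((hpow μ).smul continuousOn_const).sub ((hpow β).smul hgc)
        exact hc.congr fun t ht => (hd ht).deriv
      mem_domain := fun t ht => (hmem ht).1
      continuous_apply := by
        refine (continuousOn_iff_continuous_domRestrict.1 hgc).congr fun t => ?_
        exact (hmem t.2).2.symm
      equation := fun t ht => by
        rw [rlDeriv, (hd ht.1).deriv, (hmem ht.1).2, sub_add_cancel]
      initial := hlim }
  refine ⟨u, hsol, fun w hw => IsForwardSolution.eqOn hA v hlam_pos hv hα hsol hw, fun t ht => ?_⟩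
  have s₁ := v.hasSum_diagonal (abs_relaxation_le hlam_pos hα hβ hm ht) φ
  have s₂ := v.hasSum_diagonal (abs_relaxation_le hlam_pos hα hβ hμ' ht) f
  have s : HasSum _ (u t) := (s₁.const_smul a).add (s₂.const_smul b)
  convert s using 1
  funext k
  rw [← smul_assoc a (_ : 𝕜), ← smul_assoc b (_ : 𝕜), smul_smul, smul_smul, ← add_smul, neg_mul]
  congr 3
  · rw [relaxation, relaxationProfile, ha, ← sub_eq_add_neg, ← sub_eq_add_neg]
    ring
  · rw [relaxation, relaxationProfile, hb]
    ring
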